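/- Let $\mathcal O_n=\mathbb C\{x_1,\dots,x_n\}$ be the ring of convergent power series, with maximal ideal $\mathfrak m$. Two elements $f,g\in\mathcal O_n$ are right equivalent if $\phi(f)=g$ for some $\mathbb C$-algebra automorphism $\phi$ of $\mathcal O_n$; the germs $\{f=0\}$ and $\{g=0\}$ at the origin are analytically equivalent if $g=u\,\phi(f)$ for some such $\phi$ and some unit $u\in\mathcal O_n$. Call $f\in\mathcal O_n$ $k$-determined if every $g\in\mathcal O_n$ with $g\equiv f \pmod{\mathfrak m^{k+1}}$ is right equivalent to $f$. A homogeneous polynomial of degree $m$ in $x_1,\dots,x_n$ over $\mathbb C$ is regular if it defines a smooth hypersurface in $\mathbb P^{n-1}$. Let $D(n,m)$ be the smallest integer $D>m$ such that, for every regular homogeneous polynomial $f$ of degree $m$ in $n$ variables, every $d\ge D$ and every $g\in\mathcal O_n$ such that $g-f$ has order at least $d$, the germs $\{g=0\}$ and $\{f=0\}$ at the origin are analytically equivalent. Theorem. Let $n\ge 2$ and $m\ge 3$ be integers, with $n\ge 4$ if $m=3$ and $n\ge 3$ if $m=4$. Then the Fermat polynomial $f_{n,m}=x_1^m+\cdots+x_n^m$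 is not $(n(m-2)-1)$-determined, and $D(n,m)$ exists and equals $n(m-2)+1$. Moreover, for all sufficiently small $t\ne 0$, the polynomial $g_t=f_{n,m}+t\,x_1^{m-2}\cdots x_n^{m-2}$ satisfies $g_t\equiv f_{n,m}\pmod{\mathfrak m^{n(m-2)}}$, but the germ $\{g_t=0\}$ at the origin is not analytically equivalent to the germ $\{f_{n,m}=0\}$. -/

import Mathlib

open scoped Topology

/-- A formal power series in `x_1, …, x_n` over `ℂ` is convergent if it converges absolutely at
some point `(r, …, r)` with `r > 0` (hence on the polydisc of radius `r` about the origin). -/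
def IsConvergentSeries {n : ℕ} (f : MvPowerSeries (Fin n) ℂ) : Prop :=
  ∃ r : ℝ, 0 < r ∧
    Summable fun α : Fin n →₀ ℕ => ‖MvPowerSeries.coeff α f‖ * r ^ (Finsupp.degree α)

theorem IsConvergentSeries.exists_common {n : ℕ} {f g : MvPowerSeries (Fin n) ℂ}
    (hf : IsConvergentSeries f) (hg : IsConvergentSeries g) :
    ∃ r : ℝ, 0 < r ∧
      (Summable fun α : Fin n →₀ ℕ => ‖MvPowerSeries.coeff α f‖ * r ^ (Finsupp.degree α)) ∧
      (Summable fun α : Fin n →₀ ℕ => ‖MvPowerSeries.coeff α g‖ * r ^ (Finsupp.degree α)) := by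
  obtain ⟨r, hr, hf⟩ := hf
  obtain ⟨s, hs, hg⟩ := hg
  have h0 : 0 < min r s := lt_min hr hs
  refine ⟨min r s, h0, ?_, ?_⟩
  · refine Summable.of_nonneg_of_le (fun α => by positivity) (fun α => ?_) hf
    gcongr
    exact min_le_left r s
  · refine Summable.of_nonneg_of_le (fun α => by positivity) (fun α => ?_) hg
    gcongr
    exact min_le_right r s

theorem IsConvergentSeries.add {n : ℕ} {f g : MvPowerSeries (Fin n) ℂ}
    (hf : IsConvergentSeries f) (hg : IsConvergentSeries g) : IsConvergentSeries (f + g) := by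
  obtain ⟨r, hr, h1, h2⟩ := hf.exists_common hg
  refine ⟨r, hr, Summable.of_nonneg_of_le (fun α => by positivity) (fun α => ?_) (h1.add h2)⟩
  rw [map_add, ← add_mul]
  gcongr
  exact norm_add_le _ _

theorem IsConvergentSeries.mul {n : ℕ} {f g : MvPowerSeries (Fin n) ℂ}
    (hf : IsConvergentSeries f) (hg : IsConvergentSeries g) : IsConvergentSeries (f * g) := by
  obtain ⟨r, hr, h1, h2⟩ := hf.exists_common hg
  set a : (Fin n →₀ ℕ) → ℝ := fun α => ‖MvPowerSeries.coeff α f‖ * r ^ (Finsupp.degree α) with ha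
  set b : (Fin n →₀ ℕ) → ℝ := fun α => ‖MvPowerSeries.coeff α g‖ * r ^ (Finsupp.degree α) with hb
  have ha0 : 0 ≤ a := fun α => by simp only [ha, Pi.zero_apply]; positivity
  have hb0 : 0 ≤ b := fun α => by simp only [hb, Pi.zero_apply]; positivity
  have h3 : Summable fun α => ∑ p ∈ Finset.HasAntidiagonal.antidiagonal α, a p.1 * b p.2 :=
    summable_sum_mul_antidiagonal_of_summable_mul (h1.mul_of_nonneg h2 ha0 hb0)
  refine ⟨r, hr, Summable.of_nonneg_of_le (fun α => by positivity) (fun α => ?_) h3⟩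
  have h4 : ‖MvPowerSeries.coeff α (f * g)‖ ≤ ∑ p ∈ Finset.HasAntidiagonal.antidiagonal α,
      ‖MvPowerSeries.coeff p.1 f * MvPowerSeries.coeff p.2 g‖ := by
    rw [MvPowerSeries.coeff_mul]
    exact norm_sum_le _ _
  refine (mul_le_mul_of_nonneg_right h4 (by positivity)).trans (le_of_eq ?_)
  rw [Finset.sum_mul]
  refine Finset.sum_congr rfl fun p hp => ?_
  rw [← Finset.HasAntidiagonal.mem_antidiagonal.mp hp, map_add, pow_add, norm_mul, ha, hb]
  ring

theorem isConvergentSeries_coe {n : ℕ} (p : MvPolynomial (Fin n) ℂ) :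
    IsConvergentSeries (p : MvPowerSeries (Fin n) ℂ) := by
  refine ⟨1, one_pos, summable_of_hasFiniteSupport (p.support.finite_toSet.subset fun α hα => ?_)⟩
  simpa using hα

/-- The ring `𝒪_n = ℂ{x_1, …, x_n}` of convergent power series, as a `ℂ`-subalgebra of the
formal power series. -/
noncomputable def convergentSeries (n : ℕ) : Subalgebra ℂ (MvPowerSeries (Fin n) ℂ) where
  carrier := {f | IsConvergentSeries f}
  mul_mem' hf hg := IsConvergentSeries.mul hf hg
  add_mem' hf hg := IsConvergentSeries.add hf hg
  algebraMap_mem' c := by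
    have h := isConvergentSeries_coe (n := n) (MvPolynomial.C c)
    rwa [MvPolynomial.coe_C] at h

/-- A polynomial viewed as an element of `ℂ{x_1, …, x_n}`. -/
noncomputable def polySeries {n : ℕ} (p : MvPolynomial (Fin n) ℂ) : convergentSeries n :=
  ⟨(p : MvPowerSeries (Fin n) ℂ), isConvergentSeries_coe p⟩

/-- The maximal ideal `𝔪` of `ℂ{x_1, …, x_n}`: the series without constant term. -/
noncomputable def seriesMaxIdeal (n : ℕ) : Ideal (convergentSeries n) :=
  RingHom.ker ((MvPowerSeries.constantCoeff (σ := Fin n) (R := ℂ)).comp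
    (convergentSeries n).val.toRingHom)

/-- The `k`-truncation of `f`: its image in `ℂ{x_1, …, x_n} / 𝔪 ^ (k + 1)`. -/
noncomputable def seriesTrunc {n : ℕ} (k : ℕ) (f : convergentSeries n) :
    convergentSeries n ⧸ seriesMaxIdeal n ^ (k + 1) :=
  Ideal.Quotient.mk (seriesMaxIdeal n ^ (k + 1)) f

/-- Right equivalence: some automorphism of the `ℂ`-algebra `ℂ{x_1, …, x_n}` (an analytic change
of coordinates at the origin) maps `f` to `g`. -/
def RightEquivalent {n : ℕ} (f g : convergentSeries n) : Prop :=
  ∃ φ : convergentSeries n ≃ₐ[ℂ] convergentSeries n, φ f = g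

/-- Contact equivalence, that is, analytic equivalence of the hypersurface germs `f = 0` and
`g = 0` at the origin of `ℂ ^ n`: some automorphism of `ℂ{x_1, …, x_n}` maps `f` to `g` up to
a unit, i.e. maps the ideal of the first germ onto the ideal of the second. -/
def GermsEquivalent {n : ℕ} (f g : convergentSeries n) : Prop :=
  ∃ φ : convergentSeries n ≃ₐ[ℂ] convergentSeries n, Associated (φ f) g

/-- `f` is `k`-determined: every `g` with the same `k`-truncation is right equivalent to `f`. -/
def IsDetermined {n : ℕ} (k : ℕ) (f : convergentSeries n) : Prop :=
  ∀ g : convergentSeries n, seriesTrunc k f = seriesTrunc k g → RightEquivalent f g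

/-- `f` is a regular homogeneous polynomial of degree `m`: the hypersurface `f = 0` of the
projective space `ℙ ^ (n - 1)` is smooth (no point of it annihilates all partial derivatives). -/
def IsRegularForm {n : ℕ} (m : ℕ) (f : MvPolynomial (Fin n) ℂ) : Prop :=
  f.IsHomogeneous m ∧
    ∀ x : Fin n → ℂ, x ≠ 0 → MvPolynomial.eval x f = 0 →
      ∃ i, MvPolynomial.eval x (MvPolynomial.pderiv i f) ≠ 0

/-- The integers `D > m` such that, for every regular homogeneous polynomial `f` of degree `m` in
`n` variables and every `d ≥ D`, each convergent power series `g = f + o(d)` (the difference has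
order at least `d`) defines a germ analytically equivalent to the germ `f = 0`. The number
`D(n, m)` is the least such integer. -/
def determinacyBounds (n m : ℕ) : Set ℕ :=
  {D | m < D ∧ ∀ f : MvPolynomial (Fin n) ℂ, IsRegularForm m f → ∀ d : ℕ, D ≤ d →
    ∀ g : convergentSeries n,
      (d : ℕ∞) ≤ ((g : MvPowerSeries (Fin n) ℂ) - (f : MvPowerSeries (Fin n) ℂ)).order →
        GermsEquivalent (polySeries f) g}

/-- The Fermat polynomial `x_1 ^ m + ⋯ + x_n ^ m`. -/
noncomputable def fermatPoly (n m : ℕ) : MvPolynomial (Fin n) ℂ :=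
  ∑ i, MvPolynomial.X i ^ m

/-- The polynomial `g_t = x_1 ^ m + ⋯ + x_n ^ m + t * x_1 ^ (m - 2) ⋯ x_n ^ (m - 2)`, for
`2 ≤ m`. -/
noncomputable def fermatDeformation (n m : ℕ) (t : ℂ) : MvPolynomial (Fin n) ℂ :=
  fermatPoly n m + MvPolynomial.C t * ∏ i, MvPolynomial.X i ^ (m - 2)

/-!
Put `N = n (m - 2)`; let `f` be a regular form of degree `m`.

Upper bound. By Euler's identity the partial derivatives of `f` are `n` forms of degree `m - 1`
without a common zero besides the origin, so by Macaulay's bound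
(`MvPolynomial.mem_span_of_isHomogeneous`) they generate an ideal containing all forms of degree
greater than `N`. The bound is obvious for the ideal `(x_1, …, x_n)`, and is carried over to the
Jacobian ideal by exchanging the `x_i` one at a time for general combinations `F_i` of the partial
derivatives: when `x` is exchanged for `F` with `x ^ D = c F` modulo the other generators, the
multiplication by `c` compares the two quotients (`MvPolynomial.IsRegularMod.exchange`), and it is
injective since the generators form a regular sequence in every order, a property that survives the
exchange (`MvPolynomial.IsPermRegular.update`). Hence every series `h` of order greater than `N` is
`∑ v_i ∂_i f` with `v_i` of order at least `3`, and `f(x + v) = g` can be solved for every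
convergent `g` with `ord (g - f) > N` by iterating the division operator: the quadratic remainder
of the Taylor expansion improves the order at each step, and weighted `ℓ¹` norms give the
convergence of the solution (`MvPowerSeries.exists_translate_eq`). The substitution `x ↦ x + v` is an automorphism of
the ring of convergent power series (`IsConvergentSeries.exists_algEquiv_subst`), so `f` and `g` are
even right equivalent. Fixed points in power series are always obtained from
`MvPowerSeries.exists_fixedPoint`.

Lower bound. If the germ of a polynomial `g` is analytically equivalent to that of a form of degree
`m`, the Euler derivation transported by the coordinate change shows that `w g` lies in the
Jacobian ideal of `g` for some `w` with `w(0) = m` (`convergentSeries.exists_mul_eq_sum_pderiv`). For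
`g = ∑ x_i ^ m + t M`, with `M = x_1 ^ (m - 2) ⋯ x_n ^ (m - 2)` of degree `N`, a linear functional
involving only the coefficients of `M` and of the `x_i ^ m` vanishes on the Jacobian ideal of `g`,
but takes the value `t (m - N)` at `w g`, which is nonzero for every `t ≠ 0` as `m < N`.
-/

open scoped NNReal ENNReal

/-! ### Forms with an isolated zero and Macaulay's bound -/

namespace MvPolynomial

variable {σ K : Type*} [Field K]

theorem homogeneousComponent_add_mul {F : MvPolynomial σ K} {a : ℕ} (hF : F.IsHomogeneous a)
    (p : MvPolynomial σ K) (e : ℕ) :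
    homogeneousComponent (e + a) (F * p) = F * homogeneousComponent e p := by
  conv_lhs => rw [← sum_homogeneousComponent p, Finset.mul_sum, map_sum]
  have h : ∀ i, homogeneousComponent (e + a) (F * homogeneousComponent i p) =
      if i = e then F * homogeneousComponent i p else 0 := fun i => by
    have := (hF.mul (homogeneousComponent_isHomogeneous i p))
    rw [homogeneousComponent_of_mem (n := a + i) this]
    exact if_congr (by omega) rfl rfl
  simp only [h, Finset.sum_ite_eq']
  split_ifs with he
  · rfl
  · rw [homogeneousComponent_eq_zero _ _ (by simpa using he), mul_zero]

theorem homogeneousComponent_mul_eq_zero {F : MvPolynomial σ K} {a e : ℕ}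
    (hF : F.IsHomogeneous a) (p : MvPolynomial σ K) (h : e < a) :
    homogeneousComponent e (F * p) = 0 := by
  conv_lhs => rw [← sum_homogeneousComponent p, Finset.mul_sum, map_sum]
  refine Finset.sum_eq_zero fun i _ => ?_
  rw [homogeneousComponent_of_mem (n := a + i)
    (hF.mul (homogeneousComponent_isHomogeneous i p)), if_neg (by omega)]

/-- An ideal of polynomials that contains the homogeneous components of its elements. -/
def IsGraded (I : Ideal (MvPolynomial σ K)) : Prop :=
  ∀ p ∈ I, ∀ e, homogeneousComponent e p ∈ I

theorem isGraded_span {s : Set (MvPolynomial σ K)} (hs : ∀ g ∈ s, ∃ d, g.IsHomogeneous d) :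
    IsGraded (Ideal.span s) := by
  intro p hp
  refine Submodule.span_induction ?_ ?_ ?_ ?_ hp
  · intro g hg e
    obtain ⟨d, hd⟩ := hs g hg
    rw [homogeneousComponent_of_mem (n := d) hd]
    split_ifs
    · exact Ideal.subset_span hg
    · exact zero_mem _
  · intro e
    simp
  · intro x y _ _ hx hy e
    rw [map_add]
    exact add_mem (hx e) (hy e)
  · intro r x hx hx' e
    conv in r • x => rw [← sum_homogeneousComponent r, smul_eq_mul, Finset.sum_mul]
    rw [map_sum]
    refine sum_mem fun i _ => ?_
    rcases lt_or_ge e i with h | h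
    · rw [homogeneousComponent_mul_eq_zero (homogeneousComponent_isHomogeneous i r) _ h]
      exact zero_mem _
    · obtain ⟨j, rfl⟩ := Nat.exists_eq_add_of_le' h
      rw [homogeneousComponent_add_mul (homogeneousComponent_isHomogeneous i r)]
      exact Ideal.mul_mem_left _ _ (hx' j)

/-- A form of degree `e` in `I + (G)` is congruent modulo `I` to a multiple of `G` by a form. -/
theorem IsGraded.exists_sub_mul_mem {I : Ideal (MvPolynomial σ K)} (hI : IsGraded I)
    {G p : MvPolynomial σ K} {d e : ℕ} (hG : G.IsHomogeneous d) (hp : p.IsHomogeneous e)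
    (h : p ∈ I ⊔ Ideal.span {G}) :
    ∃ q : MvPolynomial σ K, q.IsHomogeneous (e - d) ∧ (e < d → q = 0) ∧ p - G * q ∈ I := by
  obtain ⟨i, hi, j, hj, rfl⟩ := Submodule.mem_sup.1 h
  obtain ⟨r, rfl⟩ := Ideal.mem_span_singleton.1 hj
  have h1 := homogeneousComponent_eq_self hp
  have h2 := hI i hi e
  rw [map_add] at h1
  rcases lt_or_ge e d with hed | hed
  · refine ⟨0, isHomogeneous_zero _ _ _, fun _ => rfl, ?_⟩
    rw [homogeneousComponent_mul_eq_zero hG _ hed, add_zero] at h1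
    rwa [mul_zero, sub_zero, ← h1]
  · obtain ⟨c, rfl⟩ := Nat.exists_eq_add_of_le' hed
    rw [homogeneousComponent_add_mul hG] at h1
    refine ⟨homogeneousComponent c r, ?_, fun h => by omega, ?_⟩
    · rw [Nat.add_sub_cancel]
      exact homogeneousComponent_isHomogeneous c r
    · rwa [← h1, add_sub_cancel_right]

/-- `G` is a nonzerodivisor modulo `I`. -/
def IsRegularMod (I : Ideal (MvPolynomial σ K)) (G : MvPolynomial σ K) : Prop :=
  ∀ p, G * p ∈ I → p ∈ I

/-- The two terms of a regular sequence of forms may be swapped. -/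
theorem IsRegularMod.swap {I : Ideal (MvPolynomial σ K)} (hI : IsGraded I)
    {x F : MvPolynomial σ K} {d a : ℕ} (hx : x.IsHomogeneous d) (hd : 0 < d)
    (hF : F.IsHomogeneous a) (h1 : IsRegularMod I x) (h2 : IsRegularMod (I ⊔ Ideal.span {x}) F) :
    IsRegularMod I F ∧ IsRegularMod (I ⊔ Ideal.span {F}) x := by
  have key : ∀ e, ∀ p : MvPolynomial σ K, p.IsHomogeneous e → F * p ∈ I → p ∈ I := by
    intro e
    induction e using Nat.strong_induction_on with
    | _ e ih =>
      intro p hp hFp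
      obtain ⟨q, hq, hq0, hpq⟩ := hI.exists_sub_mul_mem hx hp (h2 p (Ideal.mem_sup_left hFp))
      rcases lt_or_ge e d with hed | hed
      · rwa [hq0 hed, mul_zero, sub_zero] at hpq
      · have h3 : F * q ∈ I := by
          refine h1 _ ?_
          have := sub_mem hFp (Ideal.mul_mem_left I F hpq)
          convert this using 1
          ring
        have h4 := ih (e - d) (by omega) q hq h3
        have := add_mem hpq (Ideal.mul_mem_left I x h4)
        rwa [sub_add_cancel] at this
  refine ⟨fun p hp => ?_, fun p hp => ?_⟩
  · rw [← sum_homogeneousComponent p]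
    refine sum_mem fun e _ => key e _ (homogeneousComponent_isHomogeneous e p) ?_
    rw [← homogeneousComponent_add_mul hF]
    exact hI _ hp _
  · obtain ⟨i, hi, j, hj, hij⟩ := Submodule.mem_sup.1 hp
    obtain ⟨q, rfl⟩ := Ideal.mem_span_singleton.1 hj
    have h3 : q ∈ I ⊔ Ideal.span {x} := by
      refine h2 _ ?_
      rw [← eq_sub_iff_add_eq'] at hij
      rw [hij]
      exact sub_mem (Ideal.mem_sup_right (Ideal.mul_mem_right _ _
        (Ideal.mem_span_singleton_self x))) (Ideal.mem_sup_left hi)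
    obtain ⟨i', hi', j', hj', rfl⟩ := Submodule.mem_sup.1 h3
    obtain ⟨r, rfl⟩ := Ideal.mem_span_singleton.1 hj'
    have h4 : p - F * r ∈ I := by
      refine h1 _ ?_
      have := add_mem hi (Ideal.mul_mem_left I F hi')
      convert this using 1
      linear_combination -hij
    rw [← sub_add_cancel p (F * r)]
    exact add_mem (Ideal.mem_sup_left h4) (Ideal.mem_sup_right (Ideal.mul_mem_right _ _
      (Ideal.mem_span_singleton_self F)))

theorem span_image_insert {ι : Type*} [DecidableEq ι] (g : ι → MvPolynomial σ K) (i : ι)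
    (T : Finset ι) :
    Ideal.span (g '' (insert i T : Finset ι)) = Ideal.span (g '' T) ⊔ Ideal.span {g i} := by
  rw [Finset.coe_insert, Set.image_insert_eq, Set.insert_eq, Ideal.span_union, sup_comm]

/-- A finite family of polynomials each of which is a nonzerodivisor modulo any of the
others: a regular sequence in every order. -/
def IsPermRegular {ι : Type*} (g : ι → MvPolynomial σ K) : Prop :=
  ∀ (T : Finset ι) (i : ι), i ∉ T → IsRegularMod (Ideal.span (g '' T)) (g i)

theorem isPermRegular_X : IsPermRegular (X : σ → MvPolynomial σ K) := by
  intro T i hi p hp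
  rw [mem_ideal_span_X_image] at hp ⊢
  intro μ hμ
  obtain ⟨j, hj, h⟩ := hp (Finsupp.single i 1 + μ) (by
    rw [mem_support_iff] at hμ ⊢
    rwa [coeff_X_mul])
  refine ⟨j, hj, ?_⟩
  have hij : i ≠ j := fun h => hi (h ▸ hj)
  simpa [Finsupp.single_apply, hij] using h

/-- One term of a permutable regular sequence of forms may be exchanged for any form regular
modulo the other terms. -/
theorem IsPermRegular.update {ι : Type*} [DecidableEq ι] [Fintype ι]
    {g : ι → MvPolynomial σ K} {d : ι → ℕ} (hg : ∀ i, (g i).IsHomogeneous (d i))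
    (hd : ∀ i, 0 < d i) (hreg : IsPermRegular g) {k : ι} {F : MvPolynomial σ K} {a : ℕ}
    (hF : F.IsHomogeneous a)
    (h : IsRegularMod (Ideal.span (g '' (Finset.univ.erase k : Finset ι))) F) :
    IsPermRegular (Function.update g k F) := by
  have hgr : ∀ T : Finset ι, IsGraded (Ideal.span (g '' T)) := fun T =>
    isGraded_span (by rintro _ ⟨i, _, rfl⟩; exact ⟨_, hg i⟩)
  have h1 : ∀ c : ℕ, ∀ T : Finset ι, k ∉ T → T.card + 1 + c = Fintype.card ι →
      IsRegularMod (Ideal.span (g '' T)) F := by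
    intro c
    induction c with
    | zero =>
      intro T hkT hc
      have hT : T = Finset.univ.erase k :=
        Finset.eq_of_subset_of_card_le (fun i hi => Finset.mem_erase.2
          ⟨fun h => hkT (h ▸ hi), Finset.mem_univ i⟩)
          (by rw [Finset.card_erase_of_mem (Finset.mem_univ k), Finset.card_univ]; omega)
      rwa [hT]
    | succ c ih =>
      intro T hkT hc
      obtain ⟨j, hj⟩ : ∃ j, j ∉ insert k T := by
        by_contra! hall
        have := Finset.card_le_card (fun j _ => hall j : Finset.univ ⊆ insert k T)
        rw [Finset.card_insert_of_notMem hkT, Finset.card_univ] at this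
        omega
      rw [Finset.mem_insert, not_or] at hj
      have h3 := ih (insert j T) (by
        rw [Finset.mem_insert, not_or]
        exact ⟨Ne.symm hj.1, hkT⟩) (by rw [Finset.card_insert_of_notMem hj.2]; omega)
      rw [span_image_insert] at h3
      exact (IsRegularMod.swap (hgr T) (hg j) (hd j) hF (hreg T j hj.2) h3).1
  have h2 : ∀ T : Finset ι, k ∉ T → IsRegularMod (Ideal.span (g '' T)) F := fun T hT => by
    have : T.card + 1 ≤ Fintype.card ι := by
      rw [← Finset.card_insert_of_notMem hT]
      exact Finset.card_le_univ _
    exact h1 (Fintype.card ι - (T.card + 1)) T hT (by omega)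
  have himg : ∀ T : Finset ι, k ∉ T → Function.update g k F '' T = g '' T := fun T hT =>
    Set.image_congr fun i (hi : i ∈ T) =>
      Function.update_of_ne (fun h => hT (by rwa [← h])) _ _
  intro T i hi
  by_cases hkT : k ∈ T
  · obtain ⟨T', hkT', rfl⟩ : ∃ T', k ∉ T' ∧ insert k T' = T :=
      ⟨T.erase k, Finset.notMem_erase k T, Finset.insert_erase hkT⟩
    rw [Finset.mem_insert, not_or] at hi
    rw [span_image_insert, himg T' hkT', Function.update_self, Function.update_of_ne hi.1]
    have h3 := h2 (insert i T') (by
      rw [Finset.mem_insert, not_or]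
      exact ⟨Ne.symm hi.1, hkT'⟩)
    rw [span_image_insert] at h3
    exact (IsRegularMod.swap (hgr T') (hg i) (hd i) hF (hreg T' i hi.2) h3).2
  · rw [himg T hkT]
    by_cases hik : i = k
    · subst hik
      rw [Function.update_self]
      exact h2 T hkT
    · rw [Function.update_of_ne hik]
      exact hreg T i hi

/-- `I` contains all forms of degree greater than `N - n`. For an ideal generated by `n` forms,
`N` is the sum of their degrees. -/
def ContainsForms (I : Ideal (MvPolynomial σ K)) (N n : ℕ) : Prop :=
  ∀ e, N < e + n → ∀ p : MvPolynomial σ K, p.IsHomogeneous e → p ∈ I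

theorem ContainsForms.pow {I : Ideal (MvPolynomial σ K)} (hI : IsGraded I)
    {x : MvPolynomial σ K} {d N n : ℕ} (hx : x.IsHomogeneous d)
    (h : ContainsForms (I ⊔ Ideal.span {x}) N n) (D : ℕ) :
    ContainsForms (I ⊔ Ideal.span {x ^ (D + 1)}) (N + D * d) n := by
  induction D with
  | zero => simpa using h
  | succ D ih =>
    intro e he p hp
    have hmul : (D + 1) * d = D * d + d := by ring
    obtain ⟨q, hq, hq0, hpq⟩ := hI.exists_sub_mul_mem hx hp (h e (by omega) p hp)
    rcases lt_or_ge e d with hed | hed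
    · rw [hq0 hed, mul_zero, sub_zero] at hpq
      exact Ideal.mem_sup_left hpq
    obtain ⟨i, hi, j, hj, hij⟩ := Submodule.mem_sup.1 (ih (e - d) (by omega) q hq)
    obtain ⟨r, rfl⟩ := Ideal.mem_span_singleton.1 hj
    have : p = (p - x * q + x * i) + x ^ (D + 1 + 1) * r := by
      rw [← hij]
      ring
    rw [this]
    exact add_mem (Ideal.mem_sup_left (add_mem hpq (Ideal.mul_mem_left _ _ hi)))
      (Ideal.mem_sup_right (Ideal.mul_mem_right _ _ (Ideal.mem_span_singleton_self _)))

theorem IsRegularMod.pow {I : Ideal (MvPolynomial σ K)} {x : MvPolynomial σ K}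
    (h : IsRegularMod I x) (D : ℕ) : IsRegularMod I (x ^ D) := by
  induction D with
  | zero => intro p hp; simpa using hp
  | succ D ih =>
    intro p hp
    rw [pow_succ, mul_assoc] at hp
    exact h _ (ih _ hp)

/-- If a power of the form `x` is a multiple of the form `F` modulo `I`, and `x` is regular
modulo `I`, then `F` is regular modulo `I`, and the degree from which all forms lie in `I + (x)`
changes by `deg F - deg x` when `x` is exchanged for `F`. -/
theorem IsRegularMod.exchange {I : Ideal (MvPolynomial σ K)} (hI : IsGraded I)
    {x F : MvPolynomial σ K} {d a N n : ℕ} (hx : x.IsHomogeneous d) (hd : 0 < d)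
    (hF : F.IsHomogeneous a) (hreg : IsRegularMod I x)
    (h : ContainsForms (I ⊔ Ideal.span {x}) (N + d) n) {D : ℕ}
    (hD : x ^ D ∈ I ⊔ Ideal.span {F}) :
    IsRegularMod I F ∧ ContainsForms (I ⊔ Ideal.span {F}) (N + a) n := by
  -- the exponent is enlarged so that the cofactor of `F` has a nonnegative degree
  have hD' : x ^ (D + a + 1) ∈ I ⊔ Ideal.span {F} := by
    rw [add_assoc, pow_add]
    exact Ideal.mul_mem_right _ _ hD
  obtain ⟨c, hc, -, hcF⟩ := hI.exists_sub_mul_mem hF (hx.pow (D + a + 1)) hD'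
  have hle : a ≤ d * (D + a + 1) := by nlinarith
  have hcreg : ∀ p, F * c * p ∈ I → p ∈ I := fun p hp => by
    refine hreg.pow (D + a + 1) p ?_
    have := add_mem (Ideal.mul_mem_right p I hcF) hp
    rwa [← add_mul, sub_add_cancel] at this
  refine ⟨fun p hp => hcreg p ?_, fun e he p hp => ?_⟩
  · rw [mul_comm F c, mul_assoc]
    exact Ideal.mul_mem_left _ _ hp
  · have h1 := h.pow hI hx (D + a) (d * (D + a + 1) - a + e) (by
      have : d * (D + a + 1) = (D + a) * d + d := by ring
      omega) (c * p) (hc.mul hp)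
    obtain ⟨i, hi, j, hj, hij⟩ := Submodule.mem_sup.1 h1
    obtain ⟨q, rfl⟩ := Ideal.mem_span_singleton.1 hj
    have h2 : p - F * q ∈ I := by
      refine hcreg _ ?_
      rw [show F * c * (p - F * q) = F * (i + (x ^ (D + a + 1) - F * c) * q) by
        linear_combination -F * hij]
      exact Ideal.mul_mem_left _ _ (add_mem hi (Ideal.mul_mem_right _ _ hcF))
    rw [← sub_add_cancel p (F * q)]
    exact add_mem (Ideal.mem_sup_left h2) (Ideal.mem_sup_right (Ideal.mul_mem_right _ _
      (Ideal.mem_span_singleton_self F)))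

/-- If all forms of large degree lie in `I + (x)`, then `I` has finitely many zeros on `x = 1`. -/
theorem finite_zeros_of_containsForms [Finite σ] {I : Ideal (MvPolynomial σ K)} (hI : IsGraded I)
    {x : MvPolynomial σ K} {d N n : ℕ} (hx : x.IsHomogeneous d) (hd : 0 < d)
    (h : ContainsForms (I ⊔ Ideal.span {x}) N n) :
    {z : σ → K | (∀ p ∈ I, eval z p = 0) ∧ eval z x = 1}.Finite := by
  set Z := {z : σ → K | (∀ p ∈ I, eval z p = 0) ∧ eval z x = 1}
  let ev : MvPolynomial σ K →ₐ[K] (Z → K) := aeval fun i z => z.1 i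
  have hev : ∀ p z, ev p z = eval z.1 p := fun p z => by
    have : (Pi.evalAlgHom K (fun _ : Z => K) z).comp ev = aeval z.1 := by
      ext i
      simp [ev]
    rw [← aeval_eq_eval]
    exact DFunLike.congr_fun this p
  let W : Submodule K (MvPolynomial σ K) := ⨆ i ∈ Finset.range (N + 1), homogeneousSubmodule σ K i
  have hW : W.FG := Submodule.fg_biSup _ _ fun i _ => homogeneousSubmodule_fg σ K i
  have hform : ∀ e, ∀ p : MvPolynomial σ K, p.IsHomogeneous e →
      ev p ∈ W.map ev.toLinearMap := by
    intro e
    induction e using Nat.strong_induction_on with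
    | _ e ih =>
      intro p hp
      rcases lt_or_ge N e with he | he
      · obtain ⟨q, hq, hq0, hpq⟩ := hI.exists_sub_mul_mem hx hp (h e (by omega) p hp)
        rcases lt_or_ge e d with hed | hed
        · have : ev p = 0 := by
            ext z
            rw [hq0 hed, mul_zero, sub_zero] at hpq
            rw [hev, z.2.1 p hpq, Pi.zero_apply]
          rw [this]
          exact zero_mem _
        · have : ev p = ev q := by
            ext z
            have h1 := z.2.1 _ hpq
            rw [map_sub, map_mul, z.2.2, one_mul, sub_eq_zero] at h1
            rw [hev, hev, h1]
          rw [this]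
          exact ih (e - d) (by omega) q hq
      · exact ⟨p, Submodule.mem_iSup_of_mem e (Submodule.mem_iSup_of_mem
          (Finset.mem_range.2 (by omega)) hp), rfl⟩
  have hfg : (Subalgebra.toSubmodule ev.range).FG := by
    have : Subalgebra.toSubmodule ev.range = W.map ev.toLinearMap := by
      refine le_antisymm ?_ ?_
      · rintro _ ⟨p, rfl⟩
        change ev p ∈ _
        rw [← sum_homogeneousComponent p, map_sum]
        exact sum_mem fun e _ => hform e _ (homogeneousComponent_isHomogeneous e p)
      · rintro _ ⟨p, _, rfl⟩
        exact ⟨p, rfl⟩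
    rw [this]
    exact hW.map _
  have hcoord : ∀ i, ∃ s : Set K, s.Finite ∧ ∀ z ∈ Z, z i ∈ s := by
    intro i
    obtain ⟨P, hP, hP0⟩ := IsIntegral.of_mem_of_fg ev.range hfg (ev (X i)) ⟨X i, rfl⟩
    refine ⟨{c | P.IsRoot c}, Polynomial.finite_setOfPred_isRoot hP.ne_zero, fun z hz => ?_⟩
    have h1 := congrFun hP0 ⟨z, hz⟩
    rw [← Polynomial.aeval_def] at h1
    have h2 : (Pi.evalAlgHom K (fun _ : Z => K) ⟨z, hz⟩) (Polynomial.aeval (ev (X i)) P) =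
        Polynomial.aeval (z i) P := by
      rw [← Polynomial.aeval_algHom_apply]
      simp [ev]
    simp only [Pi.evalAlgHom_apply, h1, Pi.zero_apply] at h2
    simpa [Polynomial.IsRoot] using h2.symm
  choose s hs hZs using hcoord
  exact (Set.Finite.pi' hs).subset fun z hz i => hZs i z hz

theorem IsHomogeneous.eval_smul {p : MvPolynomial σ K} {e : ℕ} (hp : p.IsHomogeneous e) (c : K)
    (z : σ → K) : eval (c • z) p = c ^ e * eval z p := by
  rw [eval_eq, eval_eq, Finset.mul_sum]
  refine Finset.sum_congr rfl fun μ hμ => ?_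
  have h1 : μ.degree = e := by
    by_contra hne
    exact (mem_support_iff.1 hμ) (hp.coeff_eq_zero hne)
  simp only [Pi.smul_apply, smul_eq_mul, mul_pow, Finset.prod_mul_distrib,
    Finset.prod_pow_eq_pow_sum]
  rw [← h1, Finsupp.degree_apply]
  ring

/-- A general linear combination `F` of the forms `f j` vanishes at none of the finitely many zeros
of `I` with `x = 1`; by homogeneity `x` vanishes at all common zeros of `I` and `F`. -/
theorem exists_form_pow_mem [Finite σ] [IsAlgClosed K] {I : Ideal (MvPolynomial σ K)}
    {ι : Type*} {f : ι → MvPolynomial σ K} {a : ℕ} (hf : ∀ j, (f j).IsHomogeneous a)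
    (hf0 : ∀ z : σ → K, z ≠ 0 → ∃ j, eval z (f j) ≠ 0)
    (hI : IsGraded I) {x : MvPolynomial σ K} {d N n : ℕ} (hx : x.IsHomogeneous d) (hd : 0 < d)
    (h : ContainsForms (I ⊔ Ideal.span {x}) N n) :
    ∃ F ∈ Submodule.span K (Set.range f), F.IsHomogeneous a ∧
      ∃ D, x ^ D ∈ I ⊔ Ideal.span {F} := by
  have hfin := finite_zeros_of_containsForms hI hx hd h
  set Z := {z : σ → K | (∀ p ∈ I, eval z p = 0) ∧ eval z x = 1}
  have hx0 : eval (0 : σ → K) x = 0 := by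
    have := hx.eval_smul 0 0
    rwa [zero_smul, zero_pow hd.ne', zero_mul] at this
  have := hfin.to_subtype
  obtain ⟨F, hF, hFZ⟩ := Module.Dual.exists_forall_mem_ne_zero_of_forall_exists
    (Submodule.span K (Set.range f)) (fun z : Z => (aeval (R := K) z.1).toLinearMap) (by
      intro z
      obtain ⟨j, hj⟩ := hf0 z.1 (by
        intro h0
        have := z.2.2
        rw [h0, hx0] at this
        exact zero_ne_one this)
      exact ⟨f j, Submodule.subset_span ⟨j, rfl⟩, by simpa [aeval_eq_eval] using hj⟩)
  have hFa : F.IsHomogeneous a := by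
    have : Submodule.span K (Set.range f) ≤ homogeneousSubmodule σ K a := by
      rw [Submodule.span_le]
      rintro _ ⟨j, rfl⟩
      exact hf j
    exact this hF
  refine ⟨F, hF, hFa, ?_⟩
  suffices x ∈ (I ⊔ Ideal.span {F}).radical from this
  rw [← vanishingIdeal_zeroLocus_eq_radical (K := K), mem_vanishingIdeal_iff]
  intro z hz
  rw [aeval_eq_eval]
  by_contra hne
  -- the zero is rescaled so that `x` takes the value `1`
  obtain ⟨c, hc⟩ := IsAlgClosed.exists_pow_nat_eq (eval z x)⁻¹ hd
  refine hFZ ⟨c • z, fun p hp => ?_, ?_⟩ ?_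
  · rw [← sum_homogeneousComponent p, map_sum]
    refine Finset.sum_eq_zero fun e _ => ?_
    rw [(homogeneousComponent_isHomogeneous e p).eval_smul]
    have := hz _ (Ideal.mem_sup_left (hI p hp e))
    rw [aeval_eq_eval] at this
    rw [this, mul_zero]
  · rw [hx.eval_smul, hc, inv_mul_cancel₀ hne]
  · have := hz F (Ideal.mem_sup_right (Ideal.mem_span_singleton_self F))
    rw [aeval_eq_eval] at this
    change aeval (c • z) F = 0
    rw [aeval_eq_eval, hFa.eval_smul]
    rw [this, mul_zero]

/-- **Macaulay's bound**: if forms of positive degree `a` in `n` variables have no common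
zero besides the origin, the ideal they generate contains all forms of degree greater than
`n * (a - 1)`. -/
theorem mem_span_of_isHomogeneous [Fintype σ] [IsAlgClosed K] {ι : Type*}
    {f : ι → MvPolynomial σ K} {a : ℕ} (ha : 0 < a)
    (hf : ∀ j, (f j).IsHomogeneous a) (hf0 : ∀ z : σ → K, z ≠ 0 → ∃ j, eval z (f j) ≠ 0)
    {e : ℕ} (he : Fintype.card σ * a < e + Fintype.card σ) {p : MvPolynomial σ K}
    (hp : p.IsHomogeneous e) : p ∈ Ideal.span (Set.range f) := by
  classical
  have key : ∀ s : Finset σ, ∃ (g : σ → MvPolynomial σ K) (d : σ → ℕ),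
      (∀ i, (g i).IsHomogeneous (d i)) ∧ (∀ i, 0 < d i) ∧
      (∀ i ∈ s, g i ∈ Submodule.span K (Set.range f) ∧ d i = a) ∧ IsPermRegular g ∧
      ContainsForms (Ideal.span (g '' (Finset.univ : Finset σ))) (∑ i, d i)
        (Fintype.card σ) := by
    intro s
    induction s using Finset.induction_on with
    | empty =>
      refine ⟨X, fun _ => 1, fun i => isHomogeneous_X _ i, fun _ => one_pos, by simp,
        isPermRegular_X, fun e he p hp => ?_⟩
      rw [mem_ideal_span_X_image]
      intro μ hμ
      have h1 : μ.degree = e := by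
        by_contra hne
        exact (mem_support_iff.1 hμ) (hp.coeff_eq_zero hne)
      have h2 : μ ≠ 0 := by
        rintro rfl
        simp at h1 he
        omega
      obtain ⟨i, hi⟩ := Finsupp.ne_iff.1 h2
      exact ⟨i, by simp, hi⟩
    | insert k s hk ih =>
      obtain ⟨g, d, hg, hd, hgs, hreg, hcon⟩ := ih
      set I := Ideal.span (g '' (Finset.univ.erase k : Finset σ)) with hIdef
      have hI : IsGraded I := isGraded_span (by rintro _ ⟨i, _, rfl⟩; exact ⟨_, hg i⟩)
      have huniv : insert k (Finset.univ.erase k) = (Finset.univ : Finset σ) :=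
        Finset.insert_erase (Finset.mem_univ k)
      rw [← huniv, span_image_insert, huniv,
        ← Finset.sum_erase_add _ _ (Finset.mem_univ k)] at hcon
      obtain ⟨F, hFf, hF, D, hD⟩ := exists_form_pow_mem hf hf0 hI (hg k) (hd k) hcon
      obtain ⟨h1, h2⟩ := (hreg _ k (Finset.notMem_erase k _)).exchange hI (hg k) (hd k) hF hcon hD
      have himg : Function.update g k F '' (Finset.univ.erase k : Finset σ) =
          g '' (Finset.univ.erase k : Finset σ) := Set.image_congr fun i hi =>
        Function.update_of_ne (Finset.ne_of_mem_erase hi) _ _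
      refine ⟨Function.update g k F, Function.update d k a, fun i => ?_, fun i => ?_,
        fun i hi => ?_, hreg.update hg hd hF h1, ?_⟩
      · rcases eq_or_ne i k with rfl | hik
        · simpa using hF
        · simpa [hik] using hg i
      · rcases eq_or_ne i k with rfl | hik
        · simpa using ha
        · simpa [hik] using hd i
      · rcases eq_or_ne i k with rfl | hik
        · simpa using hFf
        · simpa [hik] using hgs i (Finset.mem_of_mem_insert_of_ne hi hik)
      · rw [← huniv, span_image_insert, huniv, himg, Function.update_self,
          ← Finset.sum_erase_add _ _ (Finset.mem_univ k), Function.update_self,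
          Finset.sum_congr rfl fun i hi =>
            Function.update_of_ne (Finset.ne_of_mem_erase hi) a d]
        exact h2
  obtain ⟨g, d, -, -, hgs, -, hcon⟩ := key Finset.univ
  have hsum : ∑ i, d i = Fintype.card σ * a := by
    rw [Finset.sum_congr rfl fun i hi => (hgs i hi).2]
    simp
  refine (Ideal.span_le.2 ?_ : Ideal.span _ ≤ _) (hcon e (by rwa [hsum]) p hp)
  rintro _ ⟨i, hi, rfl⟩
  exact Submodule.span_le_restrictScalars K _ _ (hgs i (Finset.mem_univ i)).1

end MvPolynomial

/-! ### Orders and weighted norms of power series -/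

namespace MvPowerSeries

variable {σ : Type*}

section Order

theorem add_le_order_mul {f g : MvPowerSeries σ ℂ} {a b : ℕ} (hf : (a : ℕ∞) ≤ f.order)
    (hg : (b : ℕ∞) ≤ g.order) : ((a + b : ℕ) : ℕ∞) ≤ (f * g).order := by
  rw [Nat.cast_add]
  exact (add_le_add hf hg).trans le_order_mul

theorem le_order_add {f g : MvPowerSeries σ ℂ} {a : ℕ∞} (hf : a ≤ f.order)
    (hg : a ≤ g.order) : a ≤ (f + g).order :=
  (le_min hf hg).trans min_order_le_add

theorem le_order_sub {f g : MvPowerSeries σ ℂ} {a : ℕ∞} (hf : a ≤ f.order)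
    (hg : a ≤ g.order) : a ≤ (f - g).order := by
  rw [sub_eq_add_neg]
  exact le_order_add hf (by rwa [order_neg])

theorem le_order_sum {ι : Type*} (s : Finset ι) {f : ι → MvPowerSeries σ ℂ} {a : ℕ∞}
    (hf : ∀ i ∈ s, a ≤ (f i).order) : a ≤ (∑ i ∈ s, f i).order :=
  Finset.sum_induction f (fun g => a ≤ g.order) (fun _ _ => le_order_add)
    (by rw [order_zero]; exact le_top) hf

theorem eq_of_forall_le_order_sub {f g : MvPowerSeries σ ℂ}
    (h : ∀ k : ℕ, (k : ℕ∞) ≤ (f - g).order) : f = g := by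
  rw [← sub_eq_zero, ← order_eq_top_iff]
  exact ENat.eq_top_iff_forall_ge.2 h

theorem coeff_eq_of_le_order_sub {f g : MvPowerSeries σ ℂ} {k : ℕ}
    (h : (k : ℕ∞) ≤ (f - g).order) {α : σ →₀ ℕ} (hα : α.degree < k) :
    coeff α f = coeff α g := by
  rw [← sub_eq_zero, ← map_sub]
  exact coeff_of_lt_order (lt_of_lt_of_le (by exact_mod_cast hα) h)

theorem le_order_monomials {u : σ → MvPowerSeries σ ℂ} (hu : ∀ i, (1 : ℕ∞) ≤ (u i).order)
    (d : σ →₀ ℕ) : (d.degree : ℕ∞) ≤ (d.prod fun i e => u i ^ e).order := by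
  refine le_trans ?_ (le_order_prod _ _)
  rw [Finsupp.degree_apply, Nat.cast_sum]
  refine Finset.sum_le_sum fun i _ => ?_
  refine le_trans ?_ (le_order_pow _)
  simpa using nsmul_le_nsmul_right (hu i) (d i)

theorem le_order_monomials_sub {u w : σ → MvPowerSeries σ ℂ}
    (hu : ∀ i, (1 : ℕ∞) ≤ (u i).order) (hw : ∀ i, (1 : ℕ∞) ≤ (w i).order) {k : ℕ}
    (huw : ∀ i, ((k + 1 : ℕ) : ℕ∞) ≤ (u i - w i).order) (d : σ →₀ ℕ) :
    ((k + d.degree : ℕ) : ℕ∞) ≤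
      ((d.prod fun i e => u i ^ e) - d.prod fun i e => w i ^ e).order := by
  induction d using Finsupp.induction_linear with
  | zero => simp
  | add d₁ d₂ h₁ h₂ =>
    rw [Finsupp.prod_add_index' (by simp) (fun _ _ _ => pow_add _ _ _),
      Finsupp.prod_add_index' (by simp) (fun _ _ _ => pow_add _ _ _)]
    have h3 := add_le_order_mul h₁ (le_order_monomials hu d₂)
    have h4 := add_le_order_mul (le_order_monomials hw d₁) h₂
    set P₁ := d₁.prod fun i e => u i ^ e
    set P₂ := d₂.prod fun i e => u i ^ e
    set Q₁ := d₁.prod fun i e => w i ^ e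
    set Q₂ := d₂.prod fun i e => w i ^ e
    rw [map_add, show P₁ * P₂ - Q₁ * Q₂ = (P₁ - Q₁) * P₂ + Q₁ * (P₂ - Q₂) by ring]
    refine le_order_add (le_trans ?_ h3) (le_trans ?_ h4)
    · exact_mod_cast (by omega)
    · exact_mod_cast (by omega)
  | single i e =>
    rw [Finsupp.prod_single_index (by simp), Finsupp.prod_single_index (by simp),
      Finsupp.degree_single]
    induction e with
    | zero => simp
    | succ e ih =>
      have hpow : (e : ℕ∞) ≤ (w i ^ e).order := by
        simpa [Finsupp.prod_single_index] using le_order_monomials hw (Finsupp.single i e)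
      have h3 := add_le_order_mul (b := 1) ih (by exact_mod_cast hu i)
      have h4 := add_le_order_mul hpow (huw i)
      rw [show u i ^ (e + 1) - w i ^ (e + 1) =
        (u i ^ e - w i ^ e) * u i + w i ^ e * (u i - w i) by ring]
      exact le_order_add h3 (le_trans (by exact_mod_cast (by omega)) h4)

/-- Substitution into a series of order at least `2` gains one order of agreement. -/
theorem le_order_subst_sub [Finite σ] {u w : σ → MvPowerSeries σ ℂ}
    (hu : ∀ i, (1 : ℕ∞) ≤ (u i).order) (hw : ∀ i, (1 : ℕ∞) ≤ (w i).order) {k : ℕ}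
    (huw : ∀ i, (k : ℕ∞) ≤ (u i - w i).order) {v : MvPowerSeries σ ℂ}
    (hv : (2 : ℕ∞) ≤ v.order) : ((k + 1 : ℕ) : ℕ∞) ≤ (subst u v - subst w v).order := by
  have hsu : HasSubst u := hasSubst_of_constantCoeff_zero fun i =>
    one_le_order_iff_constCoeff_eq_zero.1 (hu i)
  have hsw : HasSubst w := hasSubst_of_constantCoeff_zero fun i =>
    one_le_order_iff_constCoeff_eq_zero.1 (hw i)
  refine nat_le_order fun e he => ?_
  rw [map_sub, coeff_subst hsu, coeff_subst hsw, sub_eq_zero]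
  refine finsum_congr fun d => ?_
  rcases lt_or_ge d.degree 2 with hd | hd
  · rw [coeff_of_lt_order (lt_of_lt_of_le (by exact_mod_cast hd) hv), zero_smul, zero_smul]
  · congr 1
    rcases k with _ | k
    · have hlt : e.degree < d.degree := by omega
      rw [coeff_of_lt_order (lt_of_lt_of_le (by exact_mod_cast hlt) (le_order_monomials hu d)),
        coeff_of_lt_order (lt_of_lt_of_le (by exact_mod_cast hlt) (le_order_monomials hw d))]
    · exact coeff_eq_of_le_order_sub (le_order_monomials_sub hu hw huw d) (by omega)

theorem le_order_subst_of_one_le [Finite σ] {u : σ → MvPowerSeries σ ℂ}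
    (hu : ∀ i, (1 : ℕ∞) ≤ (u i).order) {v : MvPowerSeries σ ℂ} {k : ℕ}
    (hv : (k : ℕ∞) ≤ v.order) : (k : ℕ∞) ≤ (subst u v).order := by
  have hsu : HasSubst u := hasSubst_of_constantCoeff_zero fun i =>
    one_le_order_iff_constCoeff_eq_zero.1 (hu i)
  refine nat_le_order fun e he => ?_
  rw [coeff_subst hsu]
  refine finsum_eq_zero_of_forall_eq_zero fun d => ?_
  rcases lt_or_ge d.degree k with hd | hd
  · rw [coeff_of_lt_order (lt_of_lt_of_le (by exact_mod_cast hd) hv), zero_smul]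
  · rw [coeff_of_lt_order (lt_of_lt_of_le (by exact_mod_cast (lt_of_lt_of_le he hd))
      (le_order_monomials hu d)), smul_zero]

end Order

section Norm

/-- The weighted `ℓ¹` norm `∑ |f_α| r ^ |α|` of a power series, with values in `[0, ∞]`; it is
finite when `f` converges absolutely at `(r, …, r)`. -/
noncomputable def wnorm (r : ℝ≥0) (f : MvPowerSeries σ ℂ) : ℝ≥0∞ :=
  ∑' α : σ →₀ ℕ, ‖coeff α f‖ₑ * (r : ℝ≥0∞) ^ α.degree

theorem wnorm_zero (r : ℝ≥0) : wnorm r (0 : MvPowerSeries σ ℂ) = 0 := by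
  simp [wnorm]

theorem wnorm_add_le (r : ℝ≥0) (f g : MvPowerSeries σ ℂ) :
    wnorm r (f + g) ≤ wnorm r f + wnorm r g := by
  rw [wnorm, wnorm, wnorm, ← ENNReal.tsum_add]
  refine ENNReal.tsum_le_tsum fun α => ?_
  rw [map_add, ← add_mul]
  gcongr
  exact enorm_add_le _ _

theorem wnorm_neg (r : ℝ≥0) (f : MvPowerSeries σ ℂ) : wnorm r (-f) = wnorm r f := by
  simp [wnorm]

theorem wnorm_sub_le (r : ℝ≥0) (f g : MvPowerSeries σ ℂ) :
    wnorm r (f - g) ≤ wnorm r f + wnorm r g := by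
  rw [sub_eq_add_neg, ← wnorm_neg r g]
  exact wnorm_add_le _ _ _

theorem wnorm_sum_le {ι : Type*} (r : ℝ≥0) (s : Finset ι) (f : ι → MvPowerSeries σ ℂ) :
    wnorm r (∑ i ∈ s, f i) ≤ ∑ i ∈ s, wnorm r (f i) := by
  classical
  induction s using Finset.induction_on with
  | empty => simp [wnorm_zero]
  | insert i s hi ih =>
    rw [Finset.sum_insert hi, Finset.sum_insert hi]
    exact (wnorm_add_le _ _ _).trans (by gcongr)

theorem wnorm_monomial (r : ℝ≥0) (α : σ →₀ ℕ) (c : ℂ) :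
    wnorm r (monomial α c) = ‖c‖ₑ * (r : ℝ≥0∞) ^ α.degree := by
  classical
  rw [wnorm, tsum_eq_single α fun β hβ => by rw [coeff_monomial_ne hβ]; simp]
  rw [coeff_monomial_same]

theorem wnorm_C (r : ℝ≥0) (c : ℂ) : wnorm r (C c : MvPowerSeries σ ℂ) = ‖c‖ₑ := by
  rw [← monomial_zero_eq_C_apply, wnorm_monomial]
  simp

theorem wnorm_one (r : ℝ≥0) : wnorm r (1 : MvPowerSeries σ ℂ) = 1 := by
  rw [← map_one C, wnorm_C]
  simp

theorem wnorm_X (r : ℝ≥0) (i : σ) : wnorm r (X i : MvPowerSeries σ ℂ) = r := by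
  rw [X, wnorm_monomial]
  simp

theorem wnorm_mul_le (r : ℝ≥0) (f g : MvPowerSeries σ ℂ) :
    wnorm r (f * g) ≤ wnorm r f * wnorm r g := by
  classical
  have h1 : wnorm r (f * g) ≤ ∑' α : σ →₀ ℕ, ∑ p ∈ Finset.HasAntidiagonal.antidiagonal α,
      (‖coeff p.1 f‖ₑ * (r : ℝ≥0∞) ^ p.1.degree) * (‖coeff p.2 g‖ₑ * (r : ℝ≥0∞) ^ p.2.degree) := by
    refine ENNReal.tsum_le_tsum fun α => ?_
    rw [coeff_mul]
    refine (mul_le_mul_left (enorm_sum_le _ _) _).trans (le_of_eq ?_)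
    rw [Finset.sum_mul]
    refine Finset.sum_congr rfl fun p hp => ?_
    rw [← Finset.HasAntidiagonal.mem_antidiagonal.mp hp, map_add, pow_add, enorm_mul]
    ring
  refine h1.trans (le_of_eq ?_)
  rw [wnorm, wnorm, ← ENNReal.tsum_mul_right]
  simp_rw [← ENNReal.tsum_mul_left]
  rw [← ENNReal.tsum_prod,
    ← (Finset.HasAntidiagonal.sigmaAntidiagonalEquivProd (A := σ →₀ ℕ)).tsum_eq,
    ENNReal.tsum_sigma']
  refine tsum_congr fun α => ?_
  rw [← Finset.tsum_subtype]
  rfl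

theorem wnorm_monomials_le {r s : ℝ≥0} {u : σ → MvPowerSeries σ ℂ}
    (hu : ∀ i, wnorm r (u i) ≤ s) (d : σ →₀ ℕ) :
    wnorm r (d.prod fun i e => u i ^ e) ≤ (s : ℝ≥0∞) ^ d.degree := by
  induction d using Finsupp.induction_linear with
  | zero => simp [wnorm_one]
  | add d₁ d₂ h₁ h₂ =>
    rw [Finsupp.prod_add_index' (by simp) (fun _ _ _ => pow_add _ _ _), map_add, pow_add]
    exact (wnorm_mul_le _ _ _).trans (mul_le_mul' h₁ h₂)
  | single i e =>
    rw [Finsupp.prod_single_index (by simp), Finsupp.degree_single]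
    induction e with
    | zero => simp [wnorm_one]
    | succ e ih =>
      rw [pow_succ, pow_succ]
      exact (wnorm_mul_le _ _ _).trans (mul_le_mul' ih (hu i))

theorem wnorm_subst_le {r s : ℝ≥0} {u : σ → MvPowerSeries σ ℂ} (hs : HasSubst u)
    (hu : ∀ i, wnorm r (u i) ≤ s) (f : MvPowerSeries σ ℂ) :
    wnorm r (subst u f) ≤ wnorm s f := by
  have h1 : ∀ e : σ →₀ ℕ, ‖coeff e (subst u f)‖ₑ ≤
      ∑' d : σ →₀ ℕ, ‖coeff d f‖ₑ * ‖coeff e (d.prod fun i e => u i ^ e)‖ₑ := fun e => by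
    rw [coeff_subst hs, finsum_eq_sum _ (coeff_subst_finite hs f e)]
    refine (enorm_sum_le _ _).trans ?_
    simp_rw [smul_eq_mul, enorm_mul]
    exact ENNReal.sum_le_tsum _
  calc wnorm r (subst u f)
      ≤ ∑' e : σ →₀ ℕ, ∑' d : σ →₀ ℕ,
          ‖coeff d f‖ₑ * (‖coeff e (d.prod fun i e => u i ^ e)‖ₑ * (r : ℝ≥0∞) ^ e.degree) := by
        refine ENNReal.tsum_le_tsum fun e => ?_
        simp_rw [← mul_assoc]
        rw [ENNReal.tsum_mul_right]
        gcongr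
        exact h1 e
    _ = ∑' d : σ →₀ ℕ, ‖coeff d f‖ₑ * wnorm r (d.prod fun i e => u i ^ e) := by
        rw [ENNReal.tsum_comm]
        simp_rw [ENNReal.tsum_mul_left]
        rfl
    _ ≤ wnorm s f := by
        refine ENNReal.tsum_le_tsum fun d => ?_
        gcongr
        exact wnorm_monomials_le hu d

theorem wnorm_mul_pow_le {r s : ℝ≥0} (hrs : r ≤ s) {f : MvPowerSeries σ ℂ} {k : ℕ}
    (hk : (k : ℕ∞) ≤ f.order) :
    wnorm r f * (s : ℝ≥0∞) ^ k ≤ (r : ℝ≥0∞) ^ k * wnorm s f := by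
  rw [wnorm, wnorm, ← ENNReal.tsum_mul_left, ← ENNReal.tsum_mul_right]
  refine ENNReal.tsum_le_tsum fun α => ?_
  rcases lt_or_ge α.degree k with hα | hα
  · rw [coeff_of_lt_order (lt_of_lt_of_le (by exact_mod_cast hα) hk)]
    simp
  · obtain ⟨c, hc⟩ := Nat.exists_eq_add_of_le hα
    rw [hc, pow_add, pow_add]
    calc _ = ‖coeff α f‖ₑ * ((r : ℝ≥0∞) ^ k * (s : ℝ≥0∞) ^ k) * (r : ℝ≥0∞) ^ c := by ring
      _ ≤ ‖coeff α f‖ₑ * ((r : ℝ≥0∞) ^ k * (s : ℝ≥0∞) ^ k) * (s : ℝ≥0∞) ^ c := by gcongr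
      _ = _ := by ring

/-- A series of order at least `k` with finite norm is `O(r ^ k)`. -/
theorem exists_wnorm_le_mul_pow {s : ℝ≥0} (hs : 0 < s) {f : MvPowerSeries σ ℂ} {k : ℕ}
    (hk : (k : ℕ∞) ≤ f.order) (hf : wnorm s f ≠ ⊤) :
    ∃ c : ℝ≥0, ∀ r ≤ s, wnorm r f ≤ ((c * r ^ k : ℝ≥0) : ℝ≥0∞) := by
  lift wnorm s f to ℝ≥0 using hf with b hb
  refine ⟨b / s ^ k, fun r hr => ?_⟩
  have h1 := wnorm_mul_pow_le hr hk
  rw [← hb, ← ENNReal.le_div_iff_mul_le] at h1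
  · refine h1.trans (le_of_eq ?_)
    rw [← ENNReal.coe_pow, ← ENNReal.coe_pow, ← ENNReal.coe_mul, ← ENNReal.coe_div (by positivity)]
    congr 1
    ring
  · left
    exact pow_ne_zero _ (by exact_mod_cast hs.ne')
  · left
    exact ENNReal.pow_ne_top ENNReal.coe_ne_top

theorem eventually_mul_le (c : ℝ≥0) {ε : ℝ≥0} (hε : 0 < ε) :
    ∀ᶠ r : ℝ≥0 in 𝓝[>] 0, c * r ≤ ε := by
  have h : Filter.Tendsto (fun r : ℝ≥0 => c * r) (𝓝[>] 0) (𝓝 (c * 0)) :=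
    ((continuous_const.mul continuous_id).tendsto 0).mono_left nhdsWithin_le_nhds
  rw [mul_zero] at h
  exact h.eventually_le_const hε

end Norm

/-- A map of tuples of power series which improves the order of agreement and preserves a ball
for the norm `wnorm r` has a fixed point in this ball. -/
theorem exists_fixedPoint {ι : Type*} {T : (ι → MvPowerSeries σ ℂ) → ι → MvPowerSeries σ ℂ}
    {e : ℕ} (hT : ∀ v, (∀ i, (e : ℕ∞) ≤ (v i).order) → ∀ i, (e : ℕ∞) ≤ (T v i).order)
    (hc : ∀ (k : ℕ) (v w), (∀ i, (e : ℕ∞) ≤ (v i).order) → (∀ i, (e : ℕ∞) ≤ (w i).order) →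
      (∀ i, (k : ℕ∞) ≤ (v i - w i).order) →
      ∀ i, ((k + 1 : ℕ) : ℕ∞) ≤ (T v i - T w i).order)
    {r : ℝ≥0} {B : ℝ≥0∞} (hB : ∀ v, (∀ i, (e : ℕ∞) ≤ (v i).order) → (∀ i, wnorm r (v i) ≤ B) →
      ∀ i, wnorm r (T v i) ≤ B) :
    ∃ v, (∀ i, (e : ℕ∞) ≤ (v i).order) ∧ (∀ i, wnorm r (v i) ≤ B) ∧ T v = v := by
  set u : ℕ → ι → MvPowerSeries σ ℂ := fun k => T^[k] 0 with hu
  have hsucc : ∀ k, u (k + 1) = T (u k) := fun k => Function.iterate_succ_apply' _ _ _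
  have hue : ∀ k i, (e : ℕ∞) ≤ (u k i).order := by
    intro k
    induction k with
    | zero => intro i; simp [hu]
    | succ k ih => rw [hsucc]; exact hT _ ih
  have huB : ∀ k i, wnorm r (u k i) ≤ B := by
    intro k
    induction k with
    | zero => intro i; simp [hu, wnorm_zero]
    | succ k ih => rw [hsucc]; exact hB _ (hue k) ih
  have hstep : ∀ (k : ℕ) (i), (k : ℕ∞) ≤ (u (k + 1) i - u k i).order := by
    intro k
    induction k with
    | zero => intro i; simp
    | succ k ih =>
      intro i
      rw [hsucc (k + 1), hsucc k]
      exact hc k _ _ (hsucc k ▸ hue (k + 1)) (hue k) (by rwa [← hsucc k]) i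
  have hdiff : ∀ (k j : ℕ) (i), (k : ℕ∞) ≤ (u (k + j) i - u k i).order := by
    intro k j i
    induction j with
    | zero => simp
    | succ j ih =>
      rw [← sub_add_sub_cancel (u (k + (j + 1)) i) (u (k + j) i) (u k i)]
      exact le_order_add (le_trans (by exact_mod_cast Nat.le_add_right k j) (hstep (k + j) i)) ih
  -- the coefficient at `α` is constant along the iteration from the index `|α| + 1` on
  let v : ι → MvPowerSeries σ ℂ := fun i α => coeff α (u (α.degree + 1) i)
  have hv : ∀ (k : ℕ) (i), (k : ℕ∞) ≤ (v i - u k i).order := by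
    intro k i
    refine nat_le_order fun α hα => ?_
    rw [map_sub, sub_eq_zero]
    change coeff α (u (α.degree + 1) i) = _
    obtain ⟨j, rfl⟩ := Nat.exists_eq_add_of_le (show α.degree + 1 ≤ k from hα)
    exact (coeff_eq_of_le_order_sub (hdiff (α.degree + 1) j i) (Nat.lt_succ_self _)).symm
  have hve : ∀ i, (e : ℕ∞) ≤ (v i).order := fun i => by
    rw [← sub_add_cancel (v i) (u e i)]
    exact le_order_add (hv e i) (hue e i)
  refine ⟨v, hve, fun i => ?_, funext fun i => eq_of_forall_le_order_sub fun k => ?_⟩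
  · rw [wnorm, ENNReal.tsum_eq_iSup_sum]
    refine iSup_le fun s => ?_
    refine le_trans (le_of_eq (Finset.sum_congr rfl fun α hα => ?_))
      ((ENNReal.sum_le_tsum s).trans (huB (s.sup Finsupp.degree + 1) i))
    have : α.degree ≤ s.sup Finsupp.degree := Finset.le_sup (f := Finsupp.degree) hα
    rw [coeff_eq_of_le_order_sub (hv (s.sup Finsupp.degree + 1) i) (Nat.lt_succ_of_le this)]
  · have h1 := hc k v (u k) hve (hue k) (hv k) i
    rw [← hsucc] at h1
    rw [← sub_sub_sub_cancel_right _ _ (u (k + 1) i)]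
    exact le_trans (by exact_mod_cast Nat.le_succ k) (le_order_sub h1 (hv (k + 1) i))

end MvPowerSeries

/-! ### Convergent changes of coordinates -/

open MvPowerSeries in
theorem isConvergentSeries_iff_wnorm {n : ℕ} {f : MvPowerSeries (Fin n) ℂ} :
    IsConvergentSeries f ↔ ∃ r : ℝ≥0, 0 < r ∧ wnorm r f ≠ ⊤ := by
  have key : ∀ r : ℝ≥0, (Summable fun α : Fin n →₀ ℕ => ‖coeff α f‖ * (r : ℝ) ^ α.degree) ↔
      wnorm r f ≠ ⊤ := fun r => by
    have h1 : wnorm r f = ∑' α : Fin n →₀ ℕ, ((‖coeff α f‖₊ * r ^ α.degree : ℝ≥0) : ℝ≥0∞) := by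
      refine tsum_congr fun α => ?_
      rw [ENNReal.coe_mul, ENNReal.coe_pow]
      rfl
    rw [h1, ENNReal.tsum_coe_ne_top_iff_summable, ← NNReal.summable_coe]
    simp
  constructor
  · rintro ⟨r, hr, h⟩
    lift r to ℝ≥0 using hr.le
    exact ⟨r, by exact_mod_cast hr, (key r).1 h⟩
  · rintro ⟨r, hr, h⟩
    exact ⟨r, by exact_mod_cast hr, (key r).2 h⟩

namespace IsConvergentSeries

open MvPowerSeries

variable {n : ℕ}

theorem exists_eventually_wnorm_le {f : MvPowerSeries (Fin n) ℂ} (hf : IsConvergentSeries f)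
    {k : ℕ} (hk : (k : ℕ∞) ≤ f.order) :
    ∃ c : ℝ≥0, ∀ᶠ r : ℝ≥0 in 𝓝[>] 0, wnorm r f ≤ ((c * r ^ k : ℝ≥0) : ℝ≥0∞) := by
  obtain ⟨s, hs, hfs⟩ := isConvergentSeries_iff_wnorm.1 hf
  obtain ⟨c, hc⟩ := exists_wnorm_le_mul_pow hs hk hfs
  refine ⟨c, ?_⟩
  filter_upwards [nhdsWithin_le_nhds (Iic_mem_nhds hs)] with r hr using hc r hr

/-- The constants of `exists_eventually_wnorm_le` may be chosen uniformly in a finite family. -/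
theorem exists_eventually_forall_wnorm_le {ι : Type*} [Finite ι] {f : ι → MvPowerSeries (Fin n) ℂ}
    (hf : ∀ i, IsConvergentSeries (f i)) {k : ℕ} (hk : ∀ i, (k : ℕ∞) ≤ (f i).order) :
    ∃ c : ℝ≥0, ∀ᶠ r : ℝ≥0 in 𝓝[>] 0, ∀ i, wnorm r (f i) ≤ ((c * r ^ k : ℝ≥0) : ℝ≥0∞) := by
  have := Fintype.ofFinite ι
  choose c hc using fun i => (hf i).exists_eventually_wnorm_le (hk i)
  refine ⟨∑ i, c i, ?_⟩
  filter_upwards [Filter.eventually_all.2 hc] with r hr i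
  refine (hr i).trans ?_
  gcongr
  exact Finset.single_le_sum (f := c) (fun _ _ => zero_le) (Finset.mem_univ i)

theorem of_wnorm_le {f : MvPowerSeries (Fin n) ℂ} {r B : ℝ≥0} (hr : 0 < r)
    (h : wnorm r f ≤ B) : IsConvergentSeries f :=
  isConvergentSeries_iff_wnorm.2 ⟨r, hr, (h.trans_lt ENNReal.coe_lt_top).ne⟩

theorem hasSubst {u : Fin n → MvPowerSeries (Fin n) ℂ} (hu : ∀ i, (1 : ℕ∞) ≤ (u i).order) :
    HasSubst u :=
  hasSubst_of_constantCoeff_zero fun i => one_le_order_iff_constCoeff_eq_zero.1 (hu i)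

protected theorem subst {u : Fin n → MvPowerSeries (Fin n) ℂ}
    (hu : ∀ i, (1 : ℕ∞) ≤ (u i).order) (hc : ∀ i, IsConvergentSeries (u i))
    {f : MvPowerSeries (Fin n) ℂ} (hf : IsConvergentSeries f) :
    IsConvergentSeries (subst u f) := by
  obtain ⟨s, hs, hfs⟩ := isConvergentSeries_iff_wnorm.1 hf
  obtain ⟨c, h⟩ := exists_eventually_forall_wnorm_le (k := 1) hc (by exact_mod_cast hu)
  obtain ⟨r, ⟨h1, h2⟩, h3⟩ :=
    ((h.and (eventually_mul_le c hs)).and self_mem_nhdsWithin).exists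
  refine isConvergentSeries_iff_wnorm.2 ⟨r, h3, ?_⟩
  refine ((wnorm_subst_le (s := s) (hasSubst hu) (fun i => ?_) f).trans_lt hfs.lt_top).ne
  exact (h1 i).trans (by rw [pow_one]; exact_mod_cast h2)

/-- The endomorphism of `ℂ{x_1, …, x_n}` given by the substitution of convergent power series
without constant term. -/
noncomputable def substHom {u : Fin n → MvPowerSeries (Fin n) ℂ}
    (hu : ∀ i, (1 : ℕ∞) ≤ (u i).order) (hc : ∀ i, IsConvergentSeries (u i)) :
    convergentSeries n →ₐ[ℂ] convergentSeries n :=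
  ((substAlgHom (hasSubst hu)).comp (convergentSeries n).val).codRestrict _ fun f => by
    rw [AlgHom.comp_apply, substAlgHom_apply]
    exact IsConvergentSeries.subst hu hc f.2

theorem coe_substHom {u : Fin n → MvPowerSeries (Fin n) ℂ}
    (hu : ∀ i, (1 : ℕ∞) ≤ (u i).order) (hc : ∀ i, IsConvergentSeries (u i))
    (f : convergentSeries n) :
    (substHom hu hc f : MvPowerSeries (Fin n) ℂ) = subst u (f : MvPowerSeries (Fin n) ℂ) := by
  rw [← substAlgHom_apply (hasSubst hu)]
  rfl

theorem one_le_order_X (i : Fin n) : (1 : ℕ∞) ≤ (X i : MvPowerSeries (Fin n) ℂ).order := by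
  rw [one_le_order_iff_constCoeff_eq_zero]
  simp

theorem X (i : Fin n) : IsConvergentSeries (X i : MvPowerSeries (Fin n) ℂ) :=
  .of_wnorm_le one_pos (wnorm_X 1 i).le

/-- The inverse function theorem for a convergent map tangent to the identity: the inverse `w` of
`x + v(x)` is the fixed point of `w ↦ x - v(w)`. -/
theorem exists_add_subst_eq_X {v : Fin n → MvPowerSeries (Fin n) ℂ}
    (hv : ∀ i, (2 : ℕ∞) ≤ (v i).order) (hc : ∀ i, IsConvergentSeries (v i)) :
    ∃ w : Fin n → MvPowerSeries (Fin n) ℂ, (∀ i, (1 : ℕ∞) ≤ (w i).order) ∧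
      (∀ i, IsConvergentSeries (w i)) ∧ ∀ i, w i + subst w (v i) = MvPowerSeries.X i := by
  obtain ⟨c, h⟩ := exists_eventually_forall_wnorm_le (k := 2) hc (by exact_mod_cast hv)
  obtain ⟨s, ⟨h1, h2⟩, hs⟩ := ((h.and (eventually_mul_le c (ε := 1 / 2) (by positivity))).and
    self_mem_nhdsWithin).exists
  replace hs : 0 < s := hs
  obtain ⟨w, hw, hwB, hfix⟩ := exists_fixedPoint (e := 1) (r := s / 2) (B := s)
    (T := fun w i => MvPowerSeries.X i - subst w (v i))
    (fun w hw i => le_order_sub (by exact_mod_cast one_le_order_X i)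
      (le_order_subst_of_one_le (by exact_mod_cast hw)
        (le_trans (by norm_num) (hv i))))
    (fun k w w' hw hw' hk i => by
      rw [sub_sub_sub_cancel_left, ← order_neg, neg_sub]
      exact le_order_subst_sub (by exact_mod_cast hw) (by exact_mod_cast hw') hk (hv i))
    (fun w hw hB i => by
      refine (wnorm_sub_le _ _ _).trans ?_
      have h3 := (wnorm_subst_le (hasSubst (by exact_mod_cast hw)) hB (v i)).trans (h1 i)
      rw [wnorm_X]
      refine (add_le_add_right h3 _).trans ?_
      rw [← ENNReal.coe_add, ENNReal.coe_le_coe]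
      calc s / 2 + c * s ^ 2 = s / 2 + (c * s) * s := by ring
        _ ≤ s / 2 + 1 / 2 * s := by gcongr
        _ = s := by
          rw [one_div, ← div_eq_inv_mul]
          exact add_halves s)
  refine ⟨w, by exact_mod_cast hw, fun i => .of_wnorm_le (half_pos hs) (hwB i), fun i => ?_⟩
  conv_lhs => rw [← hfix]
  simp only [hfix, sub_add_cancel]

/-- The substitution `x ↦ x + v(x)` with `v` of order at least `2` is an automorphism of
`ℂ{x_1, …, x_n}`. -/
theorem exists_algEquiv_subst {v : Fin n → MvPowerSeries (Fin n) ℂ}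
    (hv : ∀ i, (2 : ℕ∞) ≤ (v i).order) (hc : ∀ i, IsConvergentSeries (v i)) :
    ∃ φ : convergentSeries n ≃ₐ[ℂ] convergentSeries n, ∀ f : convergentSeries n,
      (φ f : MvPowerSeries (Fin n) ℂ) =
        subst (fun i => MvPowerSeries.X i + v i) (f : MvPowerSeries (Fin n) ℂ) := by
  -- `u` has a right inverse `w`, and `w`, being of the same form as `u`, has a right inverse too
  have key : ∀ v : Fin n → MvPowerSeries (Fin n) ℂ, (∀ i, (2 : ℕ∞) ≤ (v i).order) →
      (∀ i, IsConvergentSeries (v i)) →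
      ∃ v' : Fin n → MvPowerSeries (Fin n) ℂ, (∀ i, (2 : ℕ∞) ≤ (v' i).order) ∧
        (∀ i, IsConvergentSeries (v' i)) ∧
        ∀ i, subst (fun i => MvPowerSeries.X i + v' i) (MvPowerSeries.X i + v i) =
          (MvPowerSeries.X i : MvPowerSeries (Fin n) ℂ) := by
    intro v hv hc
    obtain ⟨w, hw, hwc, h⟩ := exists_add_subst_eq_X hv hc
    have hv' : ∀ i, w i - MvPowerSeries.X i = - subst w (v i) := fun i => by
      rw [← h i]
      ring
    refine ⟨fun i => w i - MvPowerSeries.X i, fun i => ?_, fun i => ?_, fun i => ?_⟩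
    · beta_reduce
      rw [hv', order_neg]
      exact_mod_cast le_order_subst_of_one_le (k := 2) hw (by exact_mod_cast hv i)
    · exact (convergentSeries n).sub_mem (hwc i) (IsConvergentSeries.X i)
    · simp only [add_sub_cancel]
      rw [subst_add (hasSubst hw), subst_X (hasSubst hw), h]
  have hord : ∀ v : Fin n → MvPowerSeries (Fin n) ℂ, (∀ i, (2 : ℕ∞) ≤ (v i).order) →
      ∀ i, (1 : ℕ∞) ≤ (MvPowerSeries.X i + v i).order := fun v hv i =>
    le_order_add (one_le_order_X i) (le_trans (by norm_num) (hv i))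
  have hconv : ∀ v : Fin n → MvPowerSeries (Fin n) ℂ, (∀ i, IsConvergentSeries (v i)) →
      ∀ i, IsConvergentSeries (MvPowerSeries.X i + v i) := fun v hv i =>
    (IsConvergentSeries.X i).add (hv i)
  obtain ⟨v₁, hv₁, hc₁, h₁⟩ := key v hv hc
  obtain ⟨v₂, hv₂, hc₂, h₂⟩ := key v₁ hv₁ hc₁
  have hcomp : ∀ {a b : Fin n → MvPowerSeries (Fin n) ℂ} (ha : ∀ i, (2 : ℕ∞) ≤ (a i).order)
      (hac : ∀ i, IsConvergentSeries (a i)) (hb : ∀ i, (2 : ℕ∞) ≤ (b i).order)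
      (hbc : ∀ i, IsConvergentSeries (b i)),
      (∀ i, subst (fun i => MvPowerSeries.X i + b i) (MvPowerSeries.X i + a i) =
          (MvPowerSeries.X i : MvPowerSeries (Fin n) ℂ)) →
      (substHom (hord b hb) (hconv b hbc)).comp (substHom (hord a ha) (hconv a hac)) =
        AlgHom.id ℂ _ := by
    intro a b ha hac hb hbc h
    ext1 f
    apply Subtype.ext
    rw [AlgHom.comp_apply, coe_substHom, coe_substHom,
      subst_comp_subst_apply (hasSubst (hord a ha)) (hasSubst (hord b hb)), funext h, subst_self]
    rfl
  set Φ := substHom (hord v hv) (hconv v hc)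
  set Ψ := substHom (hord v₁ hv₁) (hconv v₁ hc₁)
  have h3 : Ψ.comp Φ = AlgHom.id ℂ _ := hcomp hv hc hv₁ hc₁ h₁
  have h4 := hcomp hv₁ hc₁ hv₂ hc₂ h₂
  have h5 : substHom (hord v₂ hv₂) (hconv v₂ hc₂) = Φ := by
    rw [← AlgHom.comp_id (substHom (hord v₂ hv₂) (hconv v₂ hc₂)), ← h3, ← AlgHom.comp_assoc, h4,
      AlgHom.id_comp]
  rw [h5] at h4
  refine ⟨AlgEquiv.ofAlgHom Φ Ψ h4 h3, fun f => ?_⟩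
  exact coe_substHom (hord v hv) (hconv v hc) f

end IsConvergentSeries

/-! ### Taylor expansion of forms -/

/-- Induction on forms by Euler's identity: every form of degree `k + 1` is `∑ x_j q_j` with forms
`q_j` of degree `k`. -/
theorem MvPolynomial.IsHomogeneous.induction_on {n : ℕ}
    {P : ℕ → MvPolynomial (Fin n) ℂ → Prop} (const : ∀ c, P 0 (C c))
    (step : ∀ (k : ℕ) (q : Fin n → MvPolynomial (Fin n) ℂ), (∀ j, (q j).IsHomogeneous k) →
      (∀ j, P k (q j)) → P (k + 1) (∑ j, X j * q j))
    {k : ℕ} {p : MvPolynomial (Fin n) ℂ} (hp : p.IsHomogeneous k) : P k p := by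
  induction k generalizing p with
  | zero =>
    rw [totalDegree_eq_zero_iff_eq_C.1 ((totalDegree_zero_iff_isHomogeneous (Fin n)).2 hp)]
    exact const _
  | succ k ih =>
    have h1 : ∀ j, (C ((k + 1 : ℂ)⁻¹) * pderiv j p).IsHomogeneous k := fun j =>
      hp.pderiv.C_mul _
    have h2 : p = ∑ j, X j * (C ((k + 1 : ℂ)⁻¹) * pderiv j p) := by
      have h3 : (k + 1 : ℂ) ≠ 0 := by exact_mod_cast Nat.succ_ne_zero k
      simp_rw [mul_left_comm (X _)]
      rw [← Finset.mul_sum, hp.sum_X_mul_pderiv, nsmul_eq_mul, ← mul_assoc,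
        ← map_natCast (C : ℂ →+* MvPolynomial (Fin n) ℂ), ← map_mul, Nat.cast_succ,
        inv_mul_cancel₀ h3, map_one, one_mul]
    rw [h2]
    exact step k _ h1 fun j => ih (h1 j)

namespace MvPowerSeries

variable {n : ℕ}

/-- The translate `p(x + v)` of a polynomial `p`. -/
noncomputable def translate (v : Fin n → MvPowerSeries (Fin n) ℂ) :
    MvPolynomial (Fin n) ℂ →ₐ[ℂ] MvPowerSeries (Fin n) ℂ :=
  MvPolynomial.aeval fun i => X i + v i

/-- The increment `p(x + v) - p(x)`. -/
noncomputable def increment (v : Fin n → MvPowerSeries (Fin n) ℂ) (p : MvPolynomial (Fin n) ℂ) :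
    MvPowerSeries (Fin n) ℂ :=
  translate v p - p

/-- The remainder of order `2` in the Taylor expansion
`p(x + v) = p(x) + ∑ v_i ∂_i p(x) + ⋯`. -/
noncomputable def taylorRem (v : Fin n → MvPowerSeries (Fin n) ℂ) (p : MvPolynomial (Fin n) ℂ) :
    MvPowerSeries (Fin n) ℂ :=
  increment v p - ∑ i, v i * (MvPolynomial.pderiv i p : MvPolynomial (Fin n) ℂ)

variable (v : Fin n → MvPowerSeries (Fin n) ℂ) (q : Fin n → MvPolynomial (Fin n) ℂ)

theorem coe_sum_X_mul : ((∑ j, MvPolynomial.X j * q j : MvPolynomial (Fin n) ℂ) :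
    MvPowerSeries (Fin n) ℂ) = ∑ j, X j * (q j : MvPowerSeries (Fin n) ℂ) := by
  rw [← MvPolynomial.coeToMvPowerSeries.ringHom_apply, map_sum]
  simp

theorem translate_sum_X_mul :
    translate v (∑ j, MvPolynomial.X j * q j) = ∑ j, (X j + v j) * translate v (q j) := by
  simp [translate]

theorem increment_sum_X_mul :
    increment v (∑ j, MvPolynomial.X j * q j) =
      ∑ j, (X j * increment v (q j) + v j * translate v (q j)) := by
  rw [increment, translate_sum_X_mul, coe_sum_X_mul, ← Finset.sum_sub_distrib]
  exact Finset.sum_congr rfl fun j _ => by rw [increment]; ring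

theorem taylorRem_sum_X_mul :
    taylorRem v (∑ j, MvPolynomial.X j * q j) =
      ∑ j, (X j * taylorRem v (q j) + v j * increment v (q j)) := by
  have h : ∀ i, ((MvPolynomial.pderiv i (∑ j, MvPolynomial.X j * q j) :
      MvPolynomial (Fin n) ℂ) : MvPowerSeries (Fin n) ℂ) =
      (q i : MvPowerSeries (Fin n) ℂ) +
        ∑ j, X j * ((MvPolynomial.pderiv i (q j) : MvPolynomial (Fin n) ℂ) :
          MvPowerSeries (Fin n) ℂ) := fun i => by
    rw [← coe_sum_X_mul, ← MvPolynomial.coe_add]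
    congr 1
    rw [map_sum]
    simp_rw [Derivation.leibniz, MvPolynomial.pderiv_X, smul_eq_mul]
    rw [Finset.sum_add_distrib, add_comm]
    congr 1
    simp [Pi.single_apply]
  rw [taylorRem, increment_sum_X_mul]
  simp_rw [h, taylorRem, mul_add, mul_sub, Finset.mul_sum]
  simp only [Finset.sum_add_distrib, Finset.sum_sub_distrib]
  rw [Finset.sum_comm]
  simp_rw [mul_left_comm (v _) (X _)]
  have h2 : ∑ j, v j * increment v (q j) = ∑ j, v j * translate v (q j) -
      ∑ j, v j * (q j : MvPowerSeries (Fin n) ℂ) := by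
    rw [← Finset.sum_sub_distrib]
    exact Finset.sum_congr rfl fun j _ => mul_sub _ _ _
  rw [h2]
  ring

theorem translate_C (c : ℂ) : translate v (MvPolynomial.C c) = C c := by
  rw [translate, MvPolynomial.aeval_C]
  rfl

theorem increment_C (c : ℂ) : increment v (MvPolynomial.C c) = 0 := by
  rw [increment, translate_C, MvPolynomial.coe_C, sub_self]

theorem taylorRem_C (c : ℂ) : taylorRem v (MvPolynomial.C c) = 0 := by
  rw [taylorRem, increment_C]
  simp

variable {v}

theorem one_le_order_X_add (hv : ∀ i, (1 : ℕ∞) ≤ (v i).order) (j : Fin n) :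
    (1 : ℕ∞) ≤ (X j + v j).order :=
  le_order_add (IsConvergentSeries.one_le_order_X j) (hv j)

theorem le_order_translate (hv : ∀ i, (1 : ℕ∞) ≤ (v i).order) {k : ℕ}
    {p : MvPolynomial (Fin n) ℂ} (hp : p.IsHomogeneous k) :
    (k : ℕ∞) ≤ (translate v p).order := by
  refine hp.induction_on (P := fun k p => (k : ℕ∞) ≤ (translate v p).order) (fun c => by simp)
    (fun k q hq ih => ?_)
  rw [translate_sum_X_mul]
  refine le_order_sum _ fun j _ => ?_
  rw [add_comm k 1]
  exact add_le_order_mul (by exact_mod_cast one_le_order_X_add hv j) (ih j)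

theorem le_order_increment {e : ℕ} (hv : ∀ i, ((e + 1 : ℕ) : ℕ∞) ≤ (v i).order) {k : ℕ}
    {p : MvPolynomial (Fin n) ℂ} (hp : p.IsHomogeneous k) :
    ((k + e : ℕ) : ℕ∞) ≤ (increment v p).order := by
  have hv1 : ∀ i, (1 : ℕ∞) ≤ (v i).order := fun i => le_trans (by simp) (hv i)
  refine hp.induction_on (P := fun k p => ((k + e : ℕ) : ℕ∞) ≤ (increment v p).order)
    (fun c => by simp [increment_C]) (fun k q hq ih => ?_)
  rw [increment_sum_X_mul]
  refine le_order_sum _ fun j _ => le_order_add ?_ ?_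
  · rw [show k + 1 + e = 1 + (k + e) by ring]
    exact add_le_order_mul (by exact_mod_cast IsConvergentSeries.one_le_order_X j) (ih j)
  · rw [show k + 1 + e = (e + 1) + k by ring]
    exact add_le_order_mul (hv j) (le_order_translate hv1 (hq j))

theorem le_order_taylorRem {e : ℕ} (hv : ∀ i, ((e + 1 : ℕ) : ℕ∞) ≤ (v i).order) {k : ℕ}
    {p : MvPolynomial (Fin n) ℂ} (hp : p.IsHomogeneous k) :
    ((k + 2 * e : ℕ) : ℕ∞) ≤ (taylorRem v p).order := by
  refine hp.induction_on (P := fun k p => ((k + 2 * e : ℕ) : ℕ∞) ≤ (taylorRem v p).order)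
    (fun c => by simp [taylorRem_C]) (fun k q hq ih => ?_)
  rw [taylorRem_sum_X_mul]
  refine le_order_sum _ fun j _ => le_order_add ?_ ?_
  · rw [show k + 1 + 2 * e = 1 + (k + 2 * e) by ring]
    exact add_le_order_mul (by exact_mod_cast IsConvergentSeries.one_le_order_X j) (ih j)
  · rw [show k + 1 + 2 * e = (e + 1) + (k + e) by ring]
    exact add_le_order_mul (hv j) (le_order_increment hv (hq j))

theorem le_order_translate_sub {w : Fin n → MvPowerSeries (Fin n) ℂ} {b : ℕ}
    (hv : ∀ i, (1 : ℕ∞) ≤ (v i).order) (hw : ∀ i, (1 : ℕ∞) ≤ (w i).order)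
    (hvw : ∀ i, ((b + 1 : ℕ) : ℕ∞) ≤ (v i - w i).order) {k : ℕ}
    {p : MvPolynomial (Fin n) ℂ} (hp : p.IsHomogeneous k) :
    ((k + b : ℕ) : ℕ∞) ≤ (translate v p - translate w p).order := by
  refine hp.induction_on (P := fun k p => ((k + b : ℕ) : ℕ∞) ≤
    (translate v p - translate w p).order) (fun c => by rw [translate_C, translate_C]; simp)
    (fun k q hq ih => ?_)
  rw [translate_sum_X_mul, translate_sum_X_mul, ← Finset.sum_sub_distrib]
  refine le_order_sum _ fun j _ => ?_
  rw [show (X j + v j) * translate v (q j) - (X j + w j) * translate w (q j) =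
    (X j + w j) * (translate v (q j) - translate w (q j)) + (v j - w j) * translate v (q j) by ring]
  refine le_order_add ?_ ?_
  · rw [show k + 1 + b = 1 + (k + b) by ring]
    exact add_le_order_mul (by exact_mod_cast one_le_order_X_add hw j) (ih j)
  · rw [show k + 1 + b = (b + 1) + k by ring]
    exact add_le_order_mul (hvw j) (le_order_translate hv (hq j))

theorem le_order_taylorRem_sub {w : Fin n → MvPowerSeries (Fin n) ℂ} {b e : ℕ}
    (hv : ∀ i, ((e + 1 : ℕ) : ℕ∞) ≤ (v i).order) (hw : ∀ i, ((e + 1 : ℕ) : ℕ∞) ≤ (w i).order)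
    (hvw : ∀ i, ((b + 1 : ℕ) : ℕ∞) ≤ (v i - w i).order) {k : ℕ}
    {p : MvPolynomial (Fin n) ℂ} (hp : p.IsHomogeneous k) :
    ((k + b + e : ℕ) : ℕ∞) ≤ (taylorRem v p - taylorRem w p).order := by
  have hv1 : ∀ i, (1 : ℕ∞) ≤ (v i).order := fun i => le_trans (by simp) (hv i)
  have hw1 : ∀ i, (1 : ℕ∞) ≤ (w i).order := fun i => le_trans (by simp) (hw i)
  refine hp.induction_on (P := fun k p => ((k + b + e : ℕ) : ℕ∞) ≤
    (taylorRem v p - taylorRem w p).order) (fun c => by simp [taylorRem_C])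
    (fun k q hq ih => ?_)
  rw [taylorRem_sum_X_mul, taylorRem_sum_X_mul, ← Finset.sum_sub_distrib]
  refine le_order_sum _ fun j _ => ?_
  rw [show X j * taylorRem v (q j) + v j * increment v (q j) -
      (X j * taylorRem w (q j) + w j * increment w (q j)) =
    X j * (taylorRem v (q j) - taylorRem w (q j)) + (v j - w j) * increment v (q j) +
      w j * (translate v (q j) - translate w (q j)) by simp only [increment]; ring]
  refine le_order_add (le_order_add ?_ ?_) ?_
  · rw [show k + 1 + b + e = 1 + (k + b + e) by ring]
    exact add_le_order_mul (by exact_mod_cast IsConvergentSeries.one_le_order_X j) (ih j)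
  · rw [show k + 1 + b + e = (b + 1) + (k + e) by ring]
    exact add_le_order_mul (hvw j) (le_order_increment hv (hq j))
  · rw [show k + 1 + b + e = (e + 1) + (k + b) by ring]
    exact add_le_order_mul (hw j) (le_order_translate_sub hv1 hw1 hvw (hq j))

/-- Cauchy-type estimates for the Taylor expansion of a form: `p(x + v)` is `O(r ^ k)`, its
increment is `O(r ^ (k - 1) B)` and the remainder is `O(r ^ (k - 2) B ^ 2)` if `v` is bounded by
`B ≤ r` in the norm `wnorm r`. -/
theorem exists_wnorm_taylorRem_le {k : ℕ} {p : MvPolynomial (Fin n) ℂ} (hp : p.IsHomogeneous k) :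
    ∃ c : ℝ≥0, ∀ (r B : ℝ≥0) (v : Fin n → MvPowerSeries (Fin n) ℂ),
      (∀ i, wnorm r (v i) ≤ B) → B ≤ r →
      wnorm r (translate v p) ≤ c * r ^ k ∧
      r * wnorm r (increment v p) ≤ c * r ^ k * B ∧
      r ^ 2 * wnorm r (taylorRem v p) ≤ c * r ^ k * B ^ 2 := by
  refine hp.induction_on (P := fun k p => ∃ c : ℝ≥0, ∀ (r B : ℝ≥0)
    (v : Fin n → MvPowerSeries (Fin n) ℂ), (∀ i, wnorm r (v i) ≤ B) → B ≤ r →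
      wnorm r (translate v p) ≤ c * r ^ k ∧
      r * wnorm r (increment v p) ≤ c * r ^ k * B ∧
      r ^ 2 * wnorm r (taylorRem v p) ≤ c * r ^ k * B ^ 2) (fun a => ⟨‖a‖₊, fun r B v hB hBr => ?_⟩)
    (fun k q hq ih => ?_)
  · rw [translate_C, increment_C, taylorRem_C, wnorm_C, wnorm_zero]
    simp [enorm_eq_nnnorm]
  · choose c hc using ih
    refine ⟨∑ j, 2 * c j, fun r B v hB hBr => ?_⟩
    have hBr' : (B : ℝ≥0∞) ≤ r := by exact_mod_cast hBr
    have hX : ∀ (j : Fin n) (f : MvPowerSeries (Fin n) ℂ), wnorm r (X j * f) ≤ r * wnorm r f :=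
      fun j f => (wnorm_mul_le _ _ _).trans (by rw [wnorm_X])
    have hV : ∀ (j : Fin n) (f : MvPowerSeries (Fin n) ℂ), wnorm r (v j * f) ≤ B * wnorm r f :=
      fun j f => (wnorm_mul_le _ _ _).trans (by gcongr; exact hB j)
    rw [increment_sum_X_mul, translate_sum_X_mul, taylorRem_sum_X_mul]
    push_cast
    refine ⟨?_, ?_, ?_⟩
    · refine (wnorm_sum_le _ _ _).trans ?_
      rw [Finset.sum_mul]
      refine Finset.sum_le_sum fun j _ => ?_
      rw [add_mul]
      calc _ ≤ r * wnorm r (translate v (q j)) + B * wnorm r (translate v (q j)) :=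
            (wnorm_add_le _ _ _).trans (add_le_add (hX _ _) (hV _ _))
        _ ≤ r * (c j * r ^ k) + r * (c j * r ^ k) := by
            gcongr
            · exact (hc j r B v hB hBr).1
            · exact (hc j r B v hB hBr).1
        _ = _ := by ring
    · refine (mul_le_mul_right (wnorm_sum_le _ _ _) _).trans ?_
      rw [Finset.mul_sum, Finset.sum_mul, Finset.sum_mul]
      refine Finset.sum_le_sum fun j _ => ?_
      calc _ ≤ r * (r * wnorm r (increment v (q j)) + B * wnorm r (translate v (q j))) := by
            gcongr
            exact (wnorm_add_le _ _ _).trans (add_le_add (hX _ _) (hV _ _))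
        _ ≤ r * (c j * r ^ k * B + B * (c j * r ^ k)) := by
            exact mul_le_mul' le_rfl (add_le_add (hc j r B v hB hBr).2.1
              (mul_le_mul' le_rfl (hc j r B v hB hBr).1))
        _ = _ := by ring
    · refine (mul_le_mul_right (wnorm_sum_le _ _ _) _).trans ?_
      rw [Finset.mul_sum, Finset.sum_mul, Finset.sum_mul]
      refine Finset.sum_le_sum fun j _ => ?_
      calc _ ≤ r ^ 2 * (r * wnorm r (taylorRem v (q j)) +
              B * wnorm r (increment v (q j))) := by
            gcongr
            exact (wnorm_add_le _ _ _).trans (add_le_add (hX _ _) (hV _ _))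
        _ = r * (r ^ 2 * wnorm r (taylorRem v (q j))) +
              r * B * (r * wnorm r (increment v (q j))) := by ring
        _ ≤ r * (c j * r ^ k * B ^ 2) + r * B * (c j * r ^ k * B) := by
            exact add_le_add (mul_le_mul' le_rfl (hc j r B v hB hBr).2.2)
              (mul_le_mul' le_rfl (hc j r B v hB hBr).2.1)
        _ = _ := by ring

end MvPowerSeries

/-! ### Division by forms and finite determinacy -/

namespace MvPowerSeries

variable {n : ℕ}

theorem exists_wnorm_coe_le {k : ℕ} {p : MvPolynomial (Fin n) ℂ} (hp : p.IsHomogeneous k) :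
    ∃ c : ℝ≥0, ∀ r : ℝ≥0, wnorm r (p : MvPowerSeries (Fin n) ℂ) ≤ c * r ^ k := by
  obtain ⟨c, hc⟩ := exists_wnorm_taylorRem_le hp
  refine ⟨c, fun r => ?_⟩
  have h := (hc r 0 0 (fun i => by simp [wnorm_zero]) zero_le).1
  have h1 : translate 0 p = (p : MvPowerSeries (Fin n) ℂ) := by
    simp only [translate, Pi.zero_apply, add_zero]
    rw [← subst_coe, subst_self, id]
  rwa [h1] at h

theorem le_order_coe {k : ℕ} {p : MvPolynomial (Fin n) ℂ} (hp : p.IsHomogeneous k) :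
    (k : ℕ∞) ≤ (p : MvPowerSeries (Fin n) ℂ).order :=
  nat_le_order fun α hα => by
    rw [MvPolynomial.coeff_coe]
    exact hp.coeff_eq_zero hα.ne

/-- The cofactor of `x ^ γ` in the decomposition `h = ∑_γ x ^ γ h_γ` in which each monomial
`x ^ α` of `h` is assigned to the summand with `γ = pick α`. -/
noncomputable def cofactor (pick : (Fin n →₀ ℕ) → Fin n →₀ ℕ) (γ : Fin n →₀ ℕ)
    (h : MvPowerSeries (Fin n) ℂ) : MvPowerSeries (Fin n) ℂ :=
  fun β => if pick (β + γ) = γ then coeff (β + γ) h else 0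

variable {pick : (Fin n →₀ ℕ) → Fin n →₀ ℕ} {γ : Fin n →₀ ℕ}

theorem coeff_cofactor (β : Fin n →₀ ℕ) (h : MvPowerSeries (Fin n) ℂ) :
    coeff β (cofactor pick γ h) = if pick (β + γ) = γ then coeff (β + γ) h else 0 :=
  rfl

theorem cofactor_sub (g h : MvPowerSeries (Fin n) ℂ) :
    cofactor pick γ (g - h) = cofactor pick γ g - cofactor pick γ h := by
  ext β
  simp only [map_sub, coeff_cofactor]
  split_ifs <;> simp

theorem le_order_cofactor {k : ℕ} {h : MvPowerSeries (Fin n) ℂ}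
    (hh : ((γ.degree + k : ℕ) : ℕ∞) ≤ h.order) : (k : ℕ∞) ≤ (cofactor pick γ h).order :=
  nat_le_order fun β hβ => by
    rw [coeff_cofactor, coeff_of_lt_order (lt_of_lt_of_le _ hh), ite_self]
    rw [map_add]
    exact_mod_cast (by omega)

theorem pow_mul_wnorm_cofactor_le (r : ℝ≥0) (h : MvPowerSeries (Fin n) ℂ) :
    (r : ℝ≥0∞) ^ γ.degree * wnorm r (cofactor pick γ h) ≤ wnorm r h := by
  rw [wnorm, ← ENNReal.tsum_mul_left]
  refine le_trans (ENNReal.tsum_le_tsum fun β => ?_) (ENNReal.tsum_comp_le_tsum_of_injective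
    (add_left_injective γ) fun α => ‖coeff α h‖ₑ * (r : ℝ≥0∞) ^ α.degree)
  rw [coeff_cofactor, map_add, pow_add]
  split_ifs
  · exact le_of_eq (by ring)
  · simp

theorem sum_monomial_mul_cofactor {d : ℕ} {Γ : Finset (Fin n →₀ ℕ)}
    (hΓ : ∀ γ, γ ∈ Γ ↔ γ.degree = d)
    (hpick : ∀ α : Fin n →₀ ℕ, d ≤ α.degree → pick α ≤ α ∧ (pick α).degree = d)
    {h : MvPowerSeries (Fin n) ℂ} (hh : (d : ℕ∞) ≤ h.order) :
    ∑ γ ∈ Γ, monomial γ 1 * cofactor pick γ h = h := by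
  ext α
  rw [map_sum]
  have key : ∀ γ ∈ Γ, coeff α (monomial γ 1 * cofactor pick γ h) =
      if γ = pick α ∧ d ≤ α.degree then coeff α h else 0 := fun γ hγ => by
    rw [hΓ] at hγ
    rw [coeff_monomial_mul, one_mul, coeff_cofactor]
    by_cases hle : γ ≤ α
    · have hd : d ≤ α.degree := hγ ▸ Finsupp.degree_mono hle
      rw [if_pos hle, tsub_add_cancel_of_le hle]
      simp [hd, eq_comm]
    · rw [if_neg hle, if_neg]
      rintro ⟨rfl, hd⟩
      exact hle (hpick α hd).1
  rw [Finset.sum_congr rfl key]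
  by_cases hd : d ≤ α.degree
  · simp [hd, hΓ, (hpick α hd).2]
  · simp only [hd, and_false, if_false, Finset.sum_const_zero]
    rw [coeff_of_lt_order (lt_of_lt_of_le _ hh)]
    exact_mod_cast (by omega)

/-- If forms `f_i` of degree `a` generate an ideal containing all forms of degree `d`, then the
series of order at least `d` may be divided by the `f_i` by an additive operator which lowers the
order by `a` and is bounded by `O(r ^ (-a))` in the norms `wnorm r`. -/
theorem exists_division {a d : ℕ} (had : a ≤ d) {f : Fin n → MvPolynomial (Fin n) ℂ}
    (hf : ∀ i, (f i).IsHomogeneous a)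
    (hd : ∀ p : MvPolynomial (Fin n) ℂ, p.IsHomogeneous d → p ∈ Ideal.span (Set.range f)) :
    ∃ L : MvPowerSeries (Fin n) ℂ → Fin n → MvPowerSeries (Fin n) ℂ,
      (∀ g h i, L (g - h) i = L g i - L h i) ∧
      (∀ h : MvPowerSeries (Fin n) ℂ, (d : ℕ∞) ≤ h.order → ∑ i, L h i * f i = h) ∧
      (∀ (k : ℕ) (h : MvPowerSeries (Fin n) ℂ), ((d + k : ℕ) : ℕ∞) ≤ h.order →
        ∀ i, ((d - a + k : ℕ) : ℕ∞) ≤ (L h i).order) ∧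
      ∃ c : ℝ≥0, ∀ (r : ℝ≥0) (h i), r ^ a * wnorm r (L h i) ≤ c * wnorm r h := by
  classical
  have hP : ∀ γ : Fin n →₀ ℕ, ∃ P : Fin n → MvPolynomial (Fin n) ℂ,
      (∀ i, (P i).IsHomogeneous (d - a)) ∧
        (γ.degree = d → ∑ i, P i * f i = MvPolynomial.monomial γ 1) := by
    intro γ
    by_cases hγ : γ.degree = d
    · have hmon := MvPolynomial.isHomogeneous_monomial (R := ℂ) 1 hγ
      obtain ⟨p, hp⟩ := Ideal.mem_span_range_iff_exists_fun.1 (hd _ hmon)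
      refine ⟨fun i => MvPolynomial.homogeneousComponent (d - a) (p i), fun i =>
        MvPolynomial.homogeneousComponent_isHomogeneous _ _, fun _ => ?_⟩
      have h1 := MvPolynomial.homogeneousComponent_eq_self hmon
      rw [← hp, map_sum] at h1
      rw [← hp, ← h1]
      refine Finset.sum_congr rfl fun i _ => ?_
      rw [mul_comm (p i)]
      conv_rhs => rw [← Nat.sub_add_cancel had]
      rw [MvPolynomial.homogeneousComponent_add_mul (hf i), mul_comm]
    · exact ⟨0, fun i => MvPolynomial.isHomogeneous_zero _ _ _, fun h => absurd h hγ⟩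
  choose P hPhom hP using hP
  have hpick : ∀ α : Fin n →₀ ℕ, ∃ γ : Fin n →₀ ℕ, d ≤ α.degree → γ ≤ α ∧ γ.degree = d := by
    intro α
    by_cases h : d ≤ α.degree
    · obtain ⟨γ, h1, h2⟩ := Finsupp.exists_le_degree_eq α d h
      exact ⟨γ, fun _ => ⟨h1, h2⟩⟩
    · exact ⟨0, fun h' => absurd h' h⟩
  choose pick hpick using hpick
  set Γ : Finset (Fin n →₀ ℕ) := (Finsupp.finite_of_degree_eq (σ := Fin n) d).toFinset with hΓdef
  have hΓ : ∀ γ, γ ∈ Γ ↔ γ.degree = d := fun γ => by simp [hΓdef]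
  refine ⟨fun h i => ∑ γ ∈ Γ, cofactor pick γ h * P γ i, fun g h i => ?_, fun h hh => ?_,
    fun k h hh i => ?_, ?_⟩
  · simp_rw [cofactor_sub, sub_mul, Finset.sum_sub_distrib]
  · conv_rhs => rw [← sum_monomial_mul_cofactor hΓ hpick hh]
    simp_rw [Finset.sum_mul]
    rw [Finset.sum_comm]
    refine Finset.sum_congr rfl fun γ hγ => ?_
    simp_rw [mul_assoc, ← Finset.mul_sum]
    rw [mul_comm, ← MvPolynomial.coe_monomial, ← hP γ ((hΓ γ).1 hγ),
      ← MvPolynomial.coeToMvPowerSeries.ringHom_apply, map_sum]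
    simp
  · refine le_order_sum _ fun γ hγ => ?_
    rw [add_comm]
    rw [← (hΓ γ).1 hγ] at hh
    exact add_le_order_mul (le_order_cofactor hh) (le_order_coe (hPhom γ i))
  · choose c hc using fun γ i => exists_wnorm_coe_le (hPhom γ i)
    refine ⟨∑ γ ∈ Γ, ∑ i, c γ i, fun r h i => ?_⟩
    refine (mul_le_mul' le_rfl (wnorm_sum_le _ _ _)).trans ?_
    push_cast
    rw [Finset.mul_sum, Finset.sum_mul]
    refine Finset.sum_le_sum fun γ hγ => ?_
    calc _ ≤ (r : ℝ≥0∞) ^ a * (wnorm r (cofactor pick γ h) * (c γ i * r ^ (d - a))) := by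
          gcongr
          exact (wnorm_mul_le _ _ _).trans (mul_le_mul' le_rfl (hc γ i r))
      _ = c γ i * (r ^ γ.degree * wnorm r (cofactor pick γ h)) := by
          rw [(hΓ γ).1 hγ]
          conv_rhs => rw [← Nat.sub_add_cancel had, pow_add]
          ring
      _ ≤ _ := by
          refine mul_le_mul' ?_ (pow_mul_wnorm_cofactor_le r h)
          exact Finset.single_le_sum (f := fun i => (c γ i : ℝ≥0∞)) (fun _ _ => zero_le)
            (Finset.mem_univ i)

/-- The choice of the radius for which the ball `wnorm r v ≤ r ^ 2` is preserved: the two terms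
`h` and `q`, of size `O(r ^ (a + 3))`, are divided by forms of degree `a`. -/
theorem le_sq_of_division_le {a : ℕ} {r cL ch cQ : ℝ≥0} {N h q : ℝ≥0∞} (hr : 0 < r)
    (hsmall : cL * (ch + cQ) * r ≤ 1) (hN : r ^ a * N ≤ cL * (h + q))
    (hh : r ^ 2 * h ≤ ch * r ^ (a + 5)) (hq : r ^ 2 * q ≤ cQ * r ^ (a + 5)) :
    N ≤ (r ^ 2 : ℝ≥0) := by
  have h6 : (r : ℝ≥0∞) ^ (a + 2) * N ≤ (r : ℝ≥0∞) ^ (a + 2) * (r ^ 2 : ℝ≥0) := by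
    calc _ = (r : ℝ≥0∞) ^ 2 * (r ^ a * N) := by ring
      _ ≤ r ^ 2 * (cL * (h + q)) := mul_le_mul' le_rfl hN
      _ = cL * (r ^ 2 * h + r ^ 2 * q) := by ring
      _ ≤ cL * (ch * r ^ (a + 5) + cQ * r ^ (a + 5)) := mul_le_mul' le_rfl (add_le_add hh hq)
      _ = ((cL * (ch + cQ) * r : ℝ≥0) : ℝ≥0∞) * (r ^ (a + 2) * (r ^ 2 : ℝ≥0)) := by
        push_cast
        ring
      _ ≤ ((1 : ℝ≥0) : ℝ≥0∞) * (r ^ (a + 2) * (r ^ 2 : ℝ≥0)) :=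
        mul_le_mul' (ENNReal.coe_le_coe.2 hsmall) le_rfl
      _ = _ := by rw [ENNReal.coe_one, one_mul]
  exact (ENNReal.mul_le_mul_iff_right (pow_ne_zero _ (by exact_mod_cast hr.ne'))
    (ENNReal.pow_ne_top ENNReal.coe_ne_top)).1 h6

/-- Finite determinacy: if all forms of degree `m + e`, with `m = a + 1` and `e ≥ 2`, lie in the
ideal of the partial derivatives of the form `f` of degree `m`, then every convergent `g` with
`ord (g - f) ≥ m + e` is of the form `f(x + v)`. -/
theorem exists_translate_eq {a e : ℕ} (he : 2 ≤ e) {f : MvPolynomial (Fin n) ℂ}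
    (hf : f.IsHomogeneous (a + 1))
    (hJ : ∀ p : MvPolynomial (Fin n) ℂ, p.IsHomogeneous (a + 1 + e) →
      p ∈ Ideal.span (Set.range fun i => MvPolynomial.pderiv i f))
    {g : MvPowerSeries (Fin n) ℂ} (hg : IsConvergentSeries g)
    (hgf : ((a + 1 + e : ℕ) : ℕ∞) ≤ (g - (f : MvPowerSeries (Fin n) ℂ)).order) :
    ∃ v : Fin n → MvPowerSeries (Fin n) ℂ, (∀ i, (2 : ℕ∞) ≤ (v i).order) ∧
      (∀ i, IsConvergentSeries (v i)) ∧ translate v f = g := by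
  set h : MvPowerSeries (Fin n) ℂ := g - (f : MvPowerSeries (Fin n) ℂ) with hh
  have hhc : IsConvergentSeries h := (convergentSeries n).sub_mem hg (isConvergentSeries_coe f)
  obtain ⟨L, hLsub, hLdiv, hLord, cL, hcL⟩ :=
    exists_division (a := a) (by omega) (fun i => hf.pderiv) hJ
  rw [show a + 1 + e - a = e + 1 by omega] at hLord
  obtain ⟨cQ, hcQ⟩ := exists_wnorm_taylorRem_le hf
  obtain ⟨ch, hch⟩ := hhc.exists_eventually_wnorm_le hgf
  obtain ⟨r, ⟨⟨h1, h2⟩, h3⟩, hr⟩ := (((hch.and (eventually_mul_le (cL * (ch + cQ))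
    one_pos)).and (eventually_mul_le 1 one_pos)).and self_mem_nhdsWithin).exists
  replace hr : 0 < r := hr
  rw [one_mul] at h3
  have hord : ∀ v : Fin n → MvPowerSeries (Fin n) ℂ, (∀ i, ((e + 1 : ℕ) : ℕ∞) ≤ (v i).order) →
      ((a + 1 + e : ℕ) : ℕ∞) ≤ (h - taylorRem v f).order := fun v hv =>
    le_order_sub hgf (le_trans (by exact_mod_cast (by omega)) (le_order_taylorRem hv hf))
  have hball : ∀ v : Fin n → MvPowerSeries (Fin n) ℂ,
      (∀ i, wnorm r (v i) ≤ (r ^ 2 : ℝ≥0)) →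
      ∀ i, wnorm r (L (h - taylorRem v f) i) ≤ (r ^ 2 : ℝ≥0) := by
    intro v hB i
    have hrr : r ^ 2 ≤ r := by
      calc r ^ 2 = r * r := sq r
        _ ≤ 1 * r := by gcongr
        _ = r := one_mul r
    have h4 := (hcQ r (r ^ 2) v hB hrr).2.2
    refine le_sq_of_division_le hr h2 ((hcL r _ i).trans (mul_le_mul' le_rfl
      (wnorm_sub_le _ _ _))) ?_ (h4.trans (le_of_eq ?_))
    · refine (mul_le_mul' le_rfl h1).trans ?_
      have : r ^ 2 * (ch * r ^ (a + 1 + e)) ≤ ch * r ^ (a + 5) := by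
        calc r ^ 2 * (ch * r ^ (a + 1 + e)) = ch * r ^ (a + 3 + e) := by ring
          _ ≤ ch * r ^ (a + 5) :=
            mul_le_mul' le_rfl (pow_le_pow_of_le_one zero_le h3 (by omega))
      exact_mod_cast this
    · push_cast
      ring
  -- the equation `f(x + v) = g` is `∑ v_i ∂_i f = g - f - taylorRem v f`
  obtain ⟨v, hv, hvB, hfix⟩ := exists_fixedPoint (e := e + 1) (r := r) (B := (r ^ 2 : ℝ≥0))
    (T := fun v => L (h - taylorRem v f)) (fun v hv => hLord 0 _ (hord v hv))
    (fun k v w hv hw hvw i => by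
      rcases k with _ | k
      · exact le_trans (by exact_mod_cast (by omega))
          (le_order_sub (hLord 0 _ (hord v hv) i) (hLord 0 _ (hord w hw) i))
      · rw [← hLsub, sub_sub_sub_cancel_left]
        refine le_trans ?_ (hLord k _ ?_ i)
        · exact_mod_cast (by omega)
        · rw [← order_neg, neg_sub, show a + 1 + e + k = a + 1 + k + e by ring]
          exact le_order_taylorRem_sub hv hw hvw hf)
    (fun v _ => hball v)
  refine ⟨v, fun i => le_trans (by exact_mod_cast (by omega)) (hv i),
    fun i => .of_wnorm_le hr (hvB i), ?_⟩
  have h7 := hLdiv _ (hord v hv)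
  have h8 : L (h - taylorRem v f) = v := hfix
  rw [h8, taylorRem, increment, hh] at h7
  linear_combination h7

end MvPowerSeries

/-! ### Derivations and germ equivalence -/

namespace convergentSeries

open MvPowerSeries

variable {n : ℕ}

/-- The inverse of `1 - h` is the fixed point of `g ↦ 1 + h g`. -/
theorem exists_mul_one_sub_eq_one {h : MvPowerSeries (Fin n) ℂ} (hc : IsConvergentSeries h)
    (h0 : (1 : ℕ∞) ≤ h.order) :
    ∃ g : MvPowerSeries (Fin n) ℂ, IsConvergentSeries g ∧ g * (1 - h) = 1 := by
  obtain ⟨c, h1⟩ := hc.exists_eventually_wnorm_le (k := 1) (by exact_mod_cast h0)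
  obtain ⟨r, ⟨h2, h3⟩, hr⟩ := ((h1.and (eventually_mul_le c (ε := 1 / 2) (by positivity))).and
    self_mem_nhdsWithin).exists
  obtain ⟨g, -, hgB, hfix⟩ := exists_fixedPoint (ι := Unit) (e := 0) (r := r) (B := (2 : ℝ≥0))
    (T := fun g i => 1 + h * g i) (fun _ _ _ => by simp)
    (fun k v w _ _ hvw i => by
      rw [show 1 + h * v i - (1 + h * w i) = h * (v i - w i) by ring, add_comm k 1]
      exact add_le_order_mul (by exact_mod_cast h0) (hvw i))
    (fun v _ hB i => by
      refine (wnorm_add_le _ _ _).trans ?_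
      rw [wnorm_one]
      calc 1 + wnorm r (h * v i) ≤ 1 + ((1 / 2 : ℝ≥0) : ℝ≥0∞) * (2 : ℝ≥0) := by
            gcongr
            refine (wnorm_mul_le _ _ _).trans (mul_le_mul' (h2.trans ?_) (hB i))
            rw [pow_one]
            exact_mod_cast h3
        _ = (2 : ℝ≥0) := by
            rw [← ENNReal.coe_mul, ← ENNReal.coe_one, ← ENNReal.coe_add]
            norm_num)
  refine ⟨g (), .of_wnorm_le hr (hgB ()), ?_⟩
  have h4 : 1 + h * g () = g () := congrFun hfix ()
  linear_combination -h4

/-- The value at the origin. -/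
noncomputable def eval₀ (n : ℕ) : convergentSeries n →+* ℂ :=
  (constantCoeff (σ := Fin n) (R := ℂ)).comp (convergentSeries n).val.toRingHom

theorem eval₀_apply (f : convergentSeries n) :
    eval₀ n f = constantCoeff (f : MvPowerSeries (Fin n) ℂ) :=
  rfl

theorem eval₀_algebraMap (c : ℂ) : eval₀ n (algebraMap ℂ _ c) = c := by
  rw [eval₀_apply]
  change constantCoeff (algebraMap ℂ (MvPowerSeries (Fin n) ℂ) c) = c
  rw [MvPowerSeries.algebraMap_apply, Algebra.algebraMap_self, RingHom.id_apply, constantCoeff_C]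

theorem isUnit_sub_algebraMap {f : convergentSeries n} (hf : eval₀ n f = 0) {c : ℂ} (hc : c ≠ 0) :
    IsUnit (f - algebraMap ℂ _ c) := by
  set h : convergentSeries n := algebraMap ℂ _ c⁻¹ * f with hh
  have h0 : eval₀ n h = 0 := by rw [hh, map_mul, hf, mul_zero]
  obtain ⟨g, hg, hgh⟩ := exists_mul_one_sub_eq_one h.2 (one_le_order_iff_constCoeff_eq_zero.2 h0)
  have h1 : (⟨g, hg⟩ : convergentSeries n) * (1 - h) = 1 := Subtype.ext hgh
  have hcc : algebraMap ℂ (convergentSeries n) c * algebraMap ℂ _ c⁻¹ = 1 := by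
    rw [← map_mul, mul_inv_cancel₀ hc, map_one]
  refine IsUnit.of_mul_eq_one (-algebraMap ℂ _ c⁻¹ * ⟨g, hg⟩) ?_
  calc _ = (⟨g, hg⟩ : convergentSeries n) * (algebraMap ℂ (convergentSeries n) c *
      algebraMap ℂ _ c⁻¹ - algebraMap ℂ _ c⁻¹ * f) := by ring
    _ = 1 := by rw [hcc, ← hh, h1]

/-- Automorphisms preserve the maximal ideal: `f` with `f(0) = 0` is characterized by `f - c` being
a unit for all constants `c ≠ 0`. -/
theorem eval₀_algEquiv_eq_zero (φ : convergentSeries n ≃ₐ[ℂ] convergentSeries n)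
    {f : convergentSeries n} (hf : eval₀ n f = 0) : eval₀ n (φ f) = 0 := by
  by_contra hne
  have h1 := ((isUnit_sub_algebraMap hf hne).map φ).map (eval₀ n)
  rw [map_sub, AlgEquiv.commutes, map_sub, eval₀_algebraMap, sub_self] at h1
  exact not_isUnit_zero h1

/-- Polynomials as convergent power series. -/
noncomputable def polyHom (n : ℕ) : MvPolynomial (Fin n) ℂ →+* convergentSeries n :=
  (MvPolynomial.coeToMvPowerSeries.ringHom).codRestrict (convergentSeries n)
    isConvergentSeries_coe

theorem polyHom_apply (p : MvPolynomial (Fin n) ℂ) : polyHom n p = polySeries p :=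
  rfl

theorem polyHom_C (c : ℂ) : polyHom n (MvPolynomial.C c) = algebraMap ℂ _ c :=
  Subtype.ext (MvPolynomial.coe_C c)

/-- A derivation is given on polynomials by its values on the variables. -/
theorem derivation_polyHom (D : Derivation ℂ (convergentSeries n) (convergentSeries n))
    (p : MvPolynomial (Fin n) ℂ) :
    D (polyHom n p) = ∑ i, D (polyHom n (MvPolynomial.X i)) *
      polyHom n (MvPolynomial.pderiv i p) := by
  induction p using MvPolynomial.induction_on with
  | C c => simp [polyHom_C]
  | add p q hp hq => simp only [map_add, hp, hq, mul_add, Finset.sum_add_distrib]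
  | mul_X p j hp =>
    simp only [map_mul, Derivation.leibniz, hp, MvPolynomial.pderiv_X, smul_eq_mul, map_add,
      mul_add, Finset.sum_add_distrib]
    congr 1
    · rw [Finset.sum_eq_single j]
      · rw [Pi.single_eq_same, map_one]
        ring
      · intro i _ hij
        rw [Pi.single_eq_of_ne' hij]
        simp
      · simp
    · rw [Finset.mul_sum]
      exact Finset.sum_congr rfl fun i _ => by ring

/-- The Euler operator `∑ x_i ∂_i`, which multiplies the terms of degree `k` by `k`. -/
noncomputable def euler (f : MvPowerSeries (Fin n) ℂ) : MvPowerSeries (Fin n) ℂ :=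
  fun α => (α.degree : ℂ) * coeff α f

theorem coeff_euler (f : MvPowerSeries (Fin n) ℂ) (α : Fin n →₀ ℕ) :
    coeff α (euler f) = α.degree * coeff α f :=
  rfl

theorem euler_mul (f g : MvPowerSeries (Fin n) ℂ) :
    euler (f * g) = f * euler g + g * euler f := by
  classical
  ext α
  rw [mul_comm g, map_add, coeff_euler, coeff_mul, coeff_mul, coeff_mul, ← Finset.sum_add_distrib,
    Finset.mul_sum]
  refine Finset.sum_congr rfl fun p hp => ?_
  rw [coeff_euler, coeff_euler, ← Finset.HasAntidiagonal.mem_antidiagonal.mp hp, map_add,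
    Nat.cast_add]
  ring

theorem isConvergentSeries_euler {f : MvPowerSeries (Fin n) ℂ} (hf : IsConvergentSeries f) :
    IsConvergentSeries (euler f) := by
  obtain ⟨r, hr, h⟩ := isConvergentSeries_iff_wnorm.1 hf
  refine isConvergentSeries_iff_wnorm.2 ⟨r / 2, half_pos hr, (lt_of_le_of_lt ?_ h.lt_top).ne⟩
  refine ENNReal.tsum_le_tsum fun α => ?_
  rw [coeff_euler, enorm_mul, mul_comm ‖(α.degree : ℂ)‖ₑ, mul_assoc]
  gcongr
  have h1 : (α.degree : ℝ≥0) * (r / 2) ^ α.degree ≤ r ^ α.degree := by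
    rw [div_pow, mul_div_assoc', div_le_iff₀ (by positivity), mul_comm]
    gcongr
    exact_mod_cast Nat.lt_two_pow_self.le
  have h2 : ‖(α.degree : ℂ)‖ₑ = ((α.degree : ℝ≥0) : ℝ≥0∞) := by
    rw [enorm_eq_nnnorm]
    simp
  rw [h2]
  exact_mod_cast h1

/-- The Euler operator as a derivation of the ring of convergent power series. -/
noncomputable def eulerDerivation (n : ℕ) :
    Derivation ℂ (convergentSeries n) (convergentSeries n) :=
  Derivation.mk'
    { toFun := fun f => ⟨euler f, isConvergentSeries_euler f.2⟩
      map_add' := fun f g => Subtype.ext <| MvPowerSeries.ext fun α => by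
        simp [coeff_euler, mul_add]
      map_smul' := fun c f => Subtype.ext <| MvPowerSeries.ext fun α => by
        simp [coeff_euler, mul_left_comm] }
    fun f g => Subtype.ext (euler_mul _ _)

theorem coe_eulerDerivation (f : convergentSeries n) :
    (eulerDerivation n f : MvPowerSeries (Fin n) ℂ) = euler f :=
  rfl

theorem eval₀_eulerDerivation (f : convergentSeries n) : eval₀ n (eulerDerivation n f) = 0 := by
  rw [eval₀_apply, coe_eulerDerivation, ← coeff_zero_eq_constantCoeff_apply, coeff_euler]
  simp

theorem eulerDerivation_polyHom {m : ℕ} {p : MvPolynomial (Fin n) ℂ} (hp : p.IsHomogeneous m) :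
    eulerDerivation n (polyHom n p) = m * polyHom n p := by
  have h : euler (p : MvPowerSeries (Fin n) ℂ) =
      C (m : ℂ) * (p : MvPowerSeries (Fin n) ℂ) := by
    ext α
    rw [coeff_euler, coeff_C_mul, MvPolynomial.coeff_coe]
    by_cases hα : α.degree = m
    · rw [hα]
    · rw [hp.coeff_eq_zero hα, mul_zero, mul_zero]
  refine Subtype.ext ?_
  rw [coe_eulerDerivation]
  refine h.trans ?_
  rw [map_natCast]
  rfl

/-- If the germ of the polynomial `g` is analytically equivalent to the germ of a form of degree
`m`, then `w g` lies in the Jacobian ideal of `g` for some `w` with `w(0) = m`: the Euler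
derivation, transported by the coordinate change, multiplies `g` by such a `w`. -/
theorem exists_mul_eq_sum_pderiv {m : ℕ} {f g : MvPolynomial (Fin n) ℂ} (hf : f.IsHomogeneous m)
    (h : GermsEquivalent (polySeries f) (polySeries g)) :
    ∃ (w : convergentSeries n) (b : Fin n → convergentSeries n), eval₀ n w = m ∧
      w * polyHom n g = ∑ i, b i * polyHom n (MvPolynomial.pderiv i g) := by
  obtain ⟨φ, u, hu⟩ := h
  rw [← polyHom_apply, ← polyHom_apply] at hu
  let D : Derivation ℂ (convergentSeries n) (convergentSeries n) := Derivation.mk'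
    (φ.toLinearMap ∘ₗ (eulerDerivation n).toLinearMap ∘ₗ φ.symm.toLinearMap) fun a b => by
      simp
  have hD : ∀ a, D a = φ (eulerDerivation n (φ.symm a)) := fun a => rfl
  have h0 : ∀ a, eval₀ n (D a) = 0 := fun a =>
    eval₀_algEquiv_eq_zero φ (eval₀_eulerDerivation _)
  have h1 : D (φ (polyHom n f)) = m * φ (polyHom n f) := by
    rw [hD, AlgEquiv.symm_apply_apply, eulerDerivation_polyHom hf, map_mul, map_natCast]
  refine ⟨m + (u⁻¹ : (convergentSeries n)ˣ) * D u, fun i => D (polyHom n (MvPolynomial.X i)),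
    ?_, ?_⟩
  · rw [map_add, map_mul, h0, mul_zero, add_zero, map_natCast]
  · rw [← derivation_polyHom, ← hu, Derivation.leibniz, h1, smul_eq_mul, smul_eq_mul]
    linear_combination (φ (polyHom n f) * D u) * u.inv_mul

end convergentSeries

/-! ### The Fermat form and its deformation -/

section Fermat

variable {n m : ℕ}

/-- The exponent of the monomial `x_1 ^ (m - 2) ⋯ x_n ^ (m - 2)`. -/
noncomputable def socleExponent (n m : ℕ) : Fin n →₀ ℕ :=
  Finsupp.equivFunOnFinite.symm fun _ => m - 2

theorem socleExponent_apply (i : Fin n) : socleExponent n m i = m - 2 :=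
  rfl

theorem degree_socleExponent : (socleExponent n m).degree = n * (m - 2) := by
  rw [Finsupp.degree_eq_sum]
  simp [socleExponent_apply]

theorem fermatPoly_eq :
    fermatPoly n m = ∑ i, MvPolynomial.monomial (Finsupp.single i m) (1 : ℂ) := by
  simp_rw [fermatPoly, MvPolynomial.X_pow_eq_monomial]

theorem prod_X_pow_eq :
    ∏ i : Fin n, (MvPolynomial.X i : MvPolynomial (Fin n) ℂ) ^ (m - 2) =
      MvPolynomial.monomial (socleExponent n m) 1 := by
  rw [MvPolynomial.monomial_eq, MvPolynomial.C_1, one_mul, Finsupp.prod_fintype _ _ (by simp)]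
  rfl

theorem fermatDeformation_eq (t : ℂ) :
    fermatDeformation n m t = fermatPoly n m + MvPolynomial.monomial (socleExponent n m) t := by
  rw [fermatDeformation, prod_X_pow_eq, MvPolynomial.C_mul_monomial, mul_one]

theorem pderiv_fermatPoly (i : Fin n) :
    MvPolynomial.pderiv i (fermatPoly n m) =
      MvPolynomial.monomial (Finsupp.single i (m - 1)) (m : ℂ) := by
  rw [fermatPoly_eq, map_sum, Finset.sum_eq_single i]
  · rw [MvPolynomial.pderiv_monomial, ← Finsupp.single_tsub, Finsupp.single_eq_same, one_mul]
  · intro j _ hj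
    rw [MvPolynomial.pderiv_monomial, Finsupp.single_eq_of_ne' hj]
    simp
  · simp

theorem pderiv_fermatDeformation (t : ℂ) (i : Fin n) :
    MvPolynomial.pderiv i (fermatDeformation n m t) =
      MvPolynomial.monomial (Finsupp.single i (m - 1)) (m : ℂ) +
        MvPolynomial.monomial (socleExponent n m - Finsupp.single i 1) (t * (m - 2 : ℕ)) := by
  rw [fermatDeformation_eq, map_add, pderiv_fermatPoly, MvPolynomial.pderiv_monomial,
    socleExponent_apply]

theorem isHomogeneous_fermatPoly : (fermatPoly n m).IsHomogeneous m :=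
  MvPolynomial.IsHomogeneous.sum _ _ _ fun i _ => MvPolynomial.isHomogeneous_X_pow i m

theorem isRegularForm_fermatPoly (hm : 0 < m) : IsRegularForm m (fermatPoly n m) := by
  refine ⟨isHomogeneous_fermatPoly, fun x hx _ => ?_⟩
  obtain ⟨i, hi⟩ := Function.ne_iff.1 hx
  refine ⟨i, ?_⟩
  rw [pderiv_fermatPoly, MvPolynomial.eval_monomial, Finsupp.prod_single_index (by simp)]
  exact mul_ne_zero (by exact_mod_cast hm.ne') (pow_ne_zero _ hi)

open MvPowerSeries

/-- The linear functional `coeff_{M} - t (m - 2) / m * ∑ coeff_{x_i ^ m}`, where `M` is the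
monomial `x_1 ^ (m - 2) ⋯ x_n ^ (m - 2)`. It vanishes on the Jacobian ideal of
`x_1 ^ m + ⋯ + x_n ^ m + t M`. -/
noncomputable def socleFunctional (n m : ℕ) (t : ℂ) : MvPowerSeries (Fin n) ℂ →ₗ[ℂ] ℂ :=
  coeff (socleExponent n m) -
    (t * (m - 2 : ℕ) / m) • ∑ i, coeff (Finsupp.single i m)

theorem socleFunctional_apply (t : ℂ) (h : MvPowerSeries (Fin n) ℂ) :
    socleFunctional n m t h = coeff (socleExponent n m) h -
      t * (m - 2 : ℕ) / m * ∑ i, coeff (Finsupp.single i m) h := by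
  simp [socleFunctional]

theorem not_single_le_socleExponent {k : ℕ} (hk : m - 2 < k) (i : Fin n) :
    ¬ Finsupp.single i k ≤ socleExponent n m := fun h => by
  have := h i
  rw [Finsupp.single_eq_same, socleExponent_apply] at this
  omega

theorem exists_ne_fin (hn : 2 ≤ n) (i : Fin n) : ∃ k : Fin n, k ≠ i := by
  have : Nontrivial (Fin n) := Fin.nontrivial_iff_two_le.2 hn
  exact exists_ne i

theorem not_socleExponent_sub_le (hn : 2 ≤ n) (hm : 3 ≤ m) (h3 : m = 3 → 4 ≤ n) (i j : Fin n) :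
    ¬ socleExponent n m - Finsupp.single i 1 ≤ Finsupp.single j m := fun h => by
  -- a coordinate `k ≠ j` of the left-hand side is `m - 2 > 0`, or `m - 3` if `k = i`; in the latter
  -- case it vanishes for `m = 3`, but then a coordinate different from `i` and `j` is available
  have key : ∀ k, k ≠ j → (k = i → m = 3) → False := fun k hkj hki => by
    have := h k
    rw [Finsupp.single_eq_of_ne hkj, Finsupp.tsub_apply, socleExponent_apply] at this
    by_cases hk : k = i
    · have h4 := h3 (hki hk)
      obtain ⟨l, hl⟩ : ∃ l : Fin n, l ∉ ({i, j} : Finset (Fin n)) := by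
        by_contra! hall
        have h5 := Finset.card_le_card (fun l _ => hall l : Finset.univ ⊆ ({i, j} : Finset (Fin n)))
        have h6 := Finset.card_le_two (a := i) (b := j)
        rw [Finset.card_univ, Fintype.card_fin] at h5
        omega
      simp only [Finset.mem_insert, Finset.mem_singleton, not_or] at hl
      have h7 := h l
      rw [Finsupp.single_eq_of_ne hl.2, Finsupp.tsub_apply, socleExponent_apply,
        Finsupp.single_eq_of_ne hl.1] at h7
      omega
    · rw [Finsupp.single_eq_of_ne hk] at this
      omega
  obtain ⟨k, hk⟩ := exists_ne_fin hn j
  by_cases hki : k = i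
  · by_cases hm3 : m = 3
    · exact key k hk fun _ => hm3
    · have := h k
      rw [Finsupp.single_eq_of_ne hk, Finsupp.tsub_apply, socleExponent_apply, hki,
        Finsupp.single_eq_same] at this
      omega
  · exact key k hk fun h => absurd h hki

theorem socleFunctional_mul_pderiv (hn : 2 ≤ n) (hm : 3 ≤ m) (h3 : m = 3 → 4 ≤ n) (t : ℂ)
    (b : MvPowerSeries (Fin n) ℂ) (i : Fin n) :
    socleFunctional n m t (b * (MvPolynomial.pderiv i (fermatDeformation n m t) :
      MvPolynomial (Fin n) ℂ)) = 0 := by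
  have hle : Finsupp.single i 1 ≤ socleExponent n m := by
    rw [Finsupp.single_le_iff, socleExponent_apply]
    omega
  have h1 : coeff (socleExponent n m) (b * monomial (Finsupp.single i (m - 1)) (m : ℂ)) = 0 := by
    rw [coeff_mul_monomial, if_neg (not_single_le_socleExponent (by omega) i)]
  have h2 : coeff (socleExponent n m) (b * monomial (socleExponent n m - Finsupp.single i 1)
      (t * (m - 2 : ℕ))) = coeff (Finsupp.single i 1) b * (t * (m - 2 : ℕ)) := by
    rw [coeff_mul_monomial, if_pos tsub_le_self, tsub_tsub_cancel_of_le hle]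
  have h4 : ∀ j, coeff (Finsupp.single j m) (b * monomial (Finsupp.single i (m - 1)) (m : ℂ)) =
      if j = i then coeff (Finsupp.single i 1) b * m else 0 := fun j => by
    rw [coeff_mul_monomial]
    split_ifs with h5 h6 h6
    · rw [h6, ← Finsupp.single_tsub, show m - (m - 1) = 1 by omega]
    · have := h5 i
      rw [Finsupp.single_eq_same, Finsupp.single_eq_of_ne' h6] at this
      omega
    · rw [h6] at h5
      exact absurd (Finsupp.single_le_single.2 (Nat.sub_le m 1)) h5
    · rfl
  have h5 : ∀ j, coeff (Finsupp.single j m) (b * monomial (socleExponent n m - Finsupp.single i 1)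
      (t * (m - 2 : ℕ))) = 0 := fun j => by
    rw [coeff_mul_monomial, if_neg (not_socleExponent_sub_le hn hm h3 i j)]
  have hm0 : (m : ℂ) ≠ 0 := by
    exact_mod_cast (by omega)
  rw [pderiv_fermatDeformation, MvPolynomial.coe_add, MvPolynomial.coe_monomial,
    MvPolynomial.coe_monomial, mul_add, socleFunctional_apply, map_add, h1, h2]
  simp_rw [map_add, h4, h5, add_zero]
  rw [Finset.sum_ite_eq' Finset.univ i, if_pos (Finset.mem_univ i)]
  field_simp
  ring

theorem socleFunctional_mul_fermatDeformation (hn : 2 ≤ n) (hm : 3 ≤ m) (t : ℂ)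
    (w : MvPowerSeries (Fin n) ℂ) :
    socleFunctional n m t (w * (fermatDeformation n m t : MvPolynomial (Fin n) ℂ)) =
      t * (m - n * (m - 2 : ℕ)) / m * constantCoeff w := by
  have hg : ((fermatDeformation n m t : MvPolynomial (Fin n) ℂ) : MvPowerSeries (Fin n) ℂ) =
      ∑ j, monomial (Finsupp.single j m) 1 + monomial (socleExponent n m) t := by
    rw [fermatDeformation_eq, fermatPoly_eq, MvPolynomial.coe_add, MvPolynomial.coe_monomial,
      ← MvPolynomial.coeToMvPowerSeries.ringHom_apply, map_sum]
    simp
  have h1 : ∀ j, coeff (socleExponent n m) (w * monomial (Finsupp.single j m) (1 : ℂ)) = 0 :=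
    fun j => by rw [coeff_mul_monomial, if_neg (not_single_le_socleExponent (by omega) j)]
  have h2 : coeff (socleExponent n m) (w * monomial (socleExponent n m) t) =
      constantCoeff w * t := by
    rw [coeff_mul_monomial, if_pos le_rfl, tsub_self, coeff_zero_eq_constantCoeff_apply]
  have h4 : ∀ i j, coeff (Finsupp.single i m) (w * monomial (Finsupp.single j m) (1 : ℂ)) =
      if j = i then constantCoeff w else 0 := fun i j => by
    rw [coeff_mul_monomial]
    split_ifs with h5 h6 h6
    · rw [h6, tsub_self, coeff_zero_eq_constantCoeff_apply, mul_one]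
    · have := h5 j
      rw [Finsupp.single_eq_same, Finsupp.single_eq_of_ne h6] at this
      omega
    · exact absurd (by rw [h6]) h5
    · rfl
  have h5 : ∀ i, coeff (Finsupp.single i m) (w * monomial (socleExponent n m) t) = 0 := fun i => by
    rw [coeff_mul_monomial, if_neg]
    intro h
    obtain ⟨k, hk⟩ := exists_ne_fin hn i
    have := h k
    rw [Finsupp.single_eq_of_ne hk, socleExponent_apply] at this
    omega
  have hm0 : (m : ℂ) ≠ 0 := by
    exact_mod_cast (by omega)
  rw [hg, mul_add, Finset.mul_sum, socleFunctional_apply]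
  simp_rw [map_add, map_sum, h1, h2, h4, h5]
  simp only [Finset.sum_const_zero, zero_add, add_zero, Finset.sum_ite_eq', Finset.mem_univ,
    if_true, Finset.sum_const, Finset.card_univ, Fintype.card_fin, nsmul_eq_mul]
  field_simp

theorem lt_mul_sub_two (hn : 2 ≤ n) (hm : 3 ≤ m) (h3 : m = 3 → 4 ≤ n) (h4 : m = 4 → 3 ≤ n) :
    m < n * (m - 2) := by
  rcases (by omega : m = 3 ∨ m = 4 ∨ 5 ≤ m) with rfl | rfl | h
  · have := h3 rfl
    omega
  · have := h4 rfl
    omega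
  · calc m < 2 * (m - 2) := by omega
      _ ≤ n * (m - 2) := Nat.mul_le_mul_right _ hn

theorem not_germsEquivalent_fermatDeformation (hn : 2 ≤ n) (hm : 3 ≤ m) (h3 : m = 3 → 4 ≤ n)
    (h4 : m = 4 → 3 ≤ n) {t : ℂ} (ht : t ≠ 0) :
    ¬ GermsEquivalent (polySeries (fermatPoly n m)) (polySeries (fermatDeformation n m t)) := by
  intro h
  obtain ⟨w, b, hw, hwb⟩ :=
    convergentSeries.exists_mul_eq_sum_pderiv isHomogeneous_fermatPoly h
  have h1 : (w : MvPowerSeries (Fin n) ℂ) * (fermatDeformation n m t : MvPolynomial (Fin n) ℂ) =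
      ∑ i, (b i : MvPowerSeries (Fin n) ℂ) *
        (MvPolynomial.pderiv i (fermatDeformation n m t) : MvPolynomial (Fin n) ℂ) := by
    have := congrArg (convergentSeries n).val hwb
    rw [map_mul, map_sum] at this
    simp_rw [map_mul] at this
    exact this
  have h2 := socleFunctional_mul_fermatDeformation hn hm t (w : MvPowerSeries (Fin n) ℂ)
  rw [h1, map_sum, Finset.sum_eq_zero fun i _ => socleFunctional_mul_pderiv hn hm h3 t _ i] at h2
  rw [convergentSeries.eval₀_apply] at hw
  have hm0 : (m : ℂ) ≠ 0 := by
    exact_mod_cast (by omega)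
  rw [hw, div_mul_cancel₀ _ hm0, eq_comm, mul_eq_zero, or_iff_right ht, sub_eq_zero] at h2
  have := lt_mul_sub_two hn hm h3 h4
  have h5 : m = n * (m - 2) := by exact_mod_cast h2
  omega

theorem seriesTrunc_fermatPoly (hnm : 0 < n * (m - 2)) (t : ℂ) :
    seriesTrunc (n * (m - 2) - 1) (polySeries (fermatPoly n m)) =
      seriesTrunc (n * (m - 2) - 1) (polySeries (fermatDeformation n m t)) := by
  rw [seriesTrunc, seriesTrunc, eq_comm, Ideal.Quotient.eq, Nat.sub_add_cancel hnm,
    ← convergentSeries.polyHom_apply, ← convergentSeries.polyHom_apply, ← map_sub,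
    fermatDeformation, add_sub_cancel_left, map_mul, map_prod, mul_comm n, pow_mul]
  refine Ideal.mul_mem_left _ _ ?_
  have h : ∏ _i : Fin n, seriesMaxIdeal n ^ (m - 2) = (seriesMaxIdeal n ^ (m - 2)) ^ n := by
    simp
  rw [← h]
  refine Ideal.prod_mem_prod fun i _ => ?_
  rw [map_pow]
  refine Ideal.pow_mem_pow ?_ _
  change constantCoeff ((MvPolynomial.X i : MvPolynomial (Fin n) ℂ) : MvPowerSeries (Fin n) ℂ) = 0
  rw [MvPolynomial.coe_X, constantCoeff_X]

theorem IsRegularForm.exists_pderiv_ne_zero {f : MvPolynomial (Fin n) ℂ} (hm : 0 < m)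
    (hf : IsRegularForm m f) {z : Fin n → ℂ} (hz : z ≠ 0) :
    ∃ i, MvPolynomial.eval z (MvPolynomial.pderiv i f) ≠ 0 := by
  by_contra! h
  have h1 := congrArg (MvPolynomial.eval z) hf.1.sum_X_mul_pderiv
  rw [map_sum, Finset.sum_eq_zero fun i _ => by rw [map_mul, h i, mul_zero], map_nsmul,
    nsmul_eq_mul, eq_comm, mul_eq_zero, or_iff_right (by exact_mod_cast hm.ne')] at h1
  obtain ⟨i, hi⟩ := hf.2 z hz h1
  exact hi (h i)

/-- A regular form `f` of degree `m` is right equivalent to every `g` such that `g - f` has order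
greater than `n * (m - 2)`. -/
theorem IsRegularForm.exists_algEquiv {f : MvPolynomial (Fin n) ℂ} (hm : 2 ≤ m)
    (hnm : m < n * (m - 2)) (hf : IsRegularForm m f) {g : convergentSeries n}
    (hg : ((n * (m - 2) + 1 : ℕ) : ℕ∞) ≤
      ((g : MvPowerSeries (Fin n) ℂ) - (f : MvPowerSeries (Fin n) ℂ)).order) :
    ∃ φ : convergentSeries n ≃ₐ[ℂ] convergentSeries n, φ (polySeries f) = g := by
  obtain ⟨a, rfl⟩ := Nat.exists_eq_add_of_le' hm
  rw [Nat.add_sub_cancel] at hnm hg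
  obtain ⟨e, he⟩ := Nat.exists_eq_add_of_lt hnm
  have hdeg : n * a + 1 = a + 1 + 1 + (e + 2) := by omega
  rw [hdeg] at hg
  obtain ⟨v, hv, hvc, hvg⟩ := exists_translate_eq (a := a + 1) (e := e + 2) (by omega) hf.1
    (fun p hp => MvPolynomial.mem_span_of_isHomogeneous (a := a + 1) (by omega)
      (fun i => hf.1.pderiv) (fun z hz => hf.exists_pderiv_ne_zero (by omega) hz)
      (by rw [Fintype.card_fin, ← hdeg, mul_add]; omega) hp) g.2 hg
  obtain ⟨φ, hφ⟩ := IsConvergentSeries.exists_algEquiv_subst hv hvc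
  refine ⟨φ, Subtype.ext ?_⟩
  rw [hφ, ← hvg]
  exact subst_coe f

end Fermat

theorem theorem3p2 (n m : ℕ) (hn : 2 ≤ n) (hm : 3 ≤ m)
    (h3 : m = 3 → 4 ≤ n) (h4 : m = 4 → 3 ≤ n) :
    ¬ IsDetermined (n * (m - 2) - 1) (polySeries (fermatPoly n m)) ∧
    IsLeast (determinacyBounds n m) (n * (m - 2) + 1) ∧
    ∀ᶠ t in 𝓝[≠] (0 : ℂ),
      seriesTrunc (n * (m - 2) - 1) (polySeries (fermatPoly n m)) =
          seriesTrunc (n * (m - 2) - 1) (polySeries (fermatDeformation n m t)) ∧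
        ¬ GermsEquivalent (polySeries (fermatPoly n m)) (polySeries (fermatDeformation n m t)) := by
  have hnm := lt_mul_sub_two hn hm h3 h4
  refine ⟨fun hdet => ?_, ⟨⟨by omega, fun f hf d hd g hg => ?_⟩, fun D hD => ?_⟩, ?_⟩
  · obtain ⟨φ, hφ⟩ := hdet _ (seriesTrunc_fermatPoly (by omega) 1)
    exact not_germsEquivalent_fermatDeformation hn hm h3 h4 one_ne_zero
      ⟨φ, hφ ▸ Associated.refl _⟩
  · obtain ⟨φ, hφ⟩ := hf.exists_algEquiv (by omega) hnm (le_trans (by exact_mod_cast hd) hg)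
    exact ⟨φ, hφ ▸ Associated.refl _⟩
  · by_contra! hlt
    refine not_germsEquivalent_fermatDeformation hn hm h3 h4 one_ne_zero
      (hD.2 _ (isRegularForm_fermatPoly (by omega)) (n * (m - 2)) (by omega) _ ?_)
    change ((n * (m - 2) : ℕ) : ℕ∞) ≤ (((fermatDeformation n m 1 : MvPolynomial (Fin n) ℂ) :
      MvPowerSeries (Fin n) ℂ) - _).order
    rw [fermatDeformation_eq, MvPolynomial.coe_add, add_sub_cancel_left, ← degree_socleExponent]
    exact MvPowerSeries.le_order_coe (MvPolynomial.isHomogeneous_monomial 1 rfl)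
  · filter_upwards [self_mem_nhdsWithin] with t ht
    exact ⟨seriesTrunc_fermatPoly (by omega) t,
      not_germsEquivalent_fermatDeformation hn hm h3 h4 ht⟩
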